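/- **Theorem 2.1.** Let $n\ge 1$ and $r\ge 2$ be integers and let $c_1,C_1,A>0$ and $D$ be real numbers. There is a constant $C>0$, depending only on $n,r,c_1,C_1,A,D$, such that the following holds. Let $\Omega\subset\mathbb{R}^n$ be a polyhedral domain (a bounded connected open set that is the interior of its closure, whose closure is a finite union of simplices) with $\operatorname{diam}\Omega\le D$. Let $\mathcal{T}_h$ be a finite conforming simplicial decomposition of $\overline\Omega$, and let $h_T$ be the diameter of the element $T\in\mathcal{T}_h$. Assume that $\mathcal{T}_h$ is shape regular: each $T\in\mathcal{T}_h$ contains a ball of diameter $c_1h_T$ and is contained in a ball of radius $C_1h_T$. Let $S_h^r$ be the Lagrange finite element space of continuous functions on $\overline\Omega$ whose restriction to each $T\in\mathcal{T}_h$ is a polynomial of degree at most $r-1$, and let $I_h$ be the Lagrange interpolation operator onto $S_h^r$, i.e. $I_hf\in S_h^r$ agrees with $f$ at all points of each $T$ whose barycentric coordinates are integer multiples of $1/(r-1)$. Let $d>0$ and let $\omega\in C^\infty(\Omega)$, continuous up to the boundary of $\Omega$ (so that $I_h(\omega^2\chi)$ is defined), satisfy $$|\omega|_{W^j_\infty(\Omega)}=\max_{|\alpha|=j}\|D^\alpha\omega\|_{L_\infty(\Omega)}\le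 A\,d^{-j},\qquad 0\le j\le r .$$ Then for each $\chi\in S_h^r$ there exists $\eta\in S_h^r$, namely $\eta=I_h(\omega^2\chi)$, such that for each $T\in\mathcal{T}_h$ with $h_T\le d$, $$\|\omega^2\chi-\eta\|_{H^1(T)}\le C\left(\frac{h_T}{d}\,\|\nabla(\omega\chi)\|_{L_2(T)}+\frac{h_T}{d^2}\,\|\chi\|_{L_2(T)}\right),$$ where $\|u\|_{H^1(T)}=\left(\int_T(u^2+|\nabla u|^2)\,dx\right)^{1/2}$. -/

import Mathlib

open MeasureTheory
open scoped ENNReal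

/-- A polyhedral domain, apart from the requirement that its closure is a finite union of
`n`-simplices, which is part of `SimplicialDecomposition`: a nonempty connected open set that lies
on one side of its boundary, in the sense that it is the interior of its closure (no slits). -/
structure IsPolyhedralDomain {n : ℕ} (Ω : Set (EuclideanSpace ℝ (Fin n))) : Prop where
  isOpen : IsOpen Ω
  isConnected : IsConnected Ω
  interior_closure : interior (closure Ω) = Ω

/-- A (finite, conforming) simplicial decomposition of a polyhedral domain `Ω ⊆ ℝⁿ`: a finite
geometric simplicial complex, each of whose faces is a face of an `n`-simplex of the complex, and
whose simplices fill the closure of `Ω`. -/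
structure SimplicialDecomposition {n : ℕ} (Ω : Set (EuclideanSpace ℝ (Fin n))) where
  /-- The underlying simplicial complex; simplices are given by their vertex sets. -/
  complex : Geometry.SimplicialComplex ℝ (EuclideanSpace ℝ (Fin n))
  finite_faces : complex.faces.Finite
  pure : ∀ s ∈ complex.faces, ∃ t ∈ complex.faces, s ⊆ t ∧ t.card = n + 1
  space_eq : complex.space = closure Ω

/-- The closed simplex with the given vertices. -/
def simplexOf {n : ℕ} (s : Finset (EuclideanSpace ℝ (Fin n))) : Set (EuclideanSpace ℝ (Fin n)) :=
  convexHull ℝ (s : Set (EuclideanSpace ℝ (Fin n)))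

/-- The diameter `h_T` of the simplex `T` with the given vertices. -/
noncomputable def simplexDiam {n : ℕ} (s : Finset (EuclideanSpace ℝ (Fin n))) : ℝ :=
  Metric.diam (simplexOf s)

/-- The points of a simplex whose barycentric coordinates are integer multiples of `1 / k`:
the nodes of the Lagrange element of degree `k`. -/
def lagrangeNodes {n : ℕ} (k : ℕ) (s : Finset (EuclideanSpace ℝ (Fin n))) :
    Set (EuclideanSpace ℝ (Fin n)) :=
  {z | ∃ a : EuclideanSpace ℝ (Fin n) → ℕ,
    ∑ v ∈ s, a v = k ∧ z = ∑ v ∈ s, ((a v : ℝ) / (k : ℝ)) • v}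

namespace SimplicialDecomposition

variable {n : ℕ} {Ω : Set (EuclideanSpace ℝ (Fin n))}

/-- The elements of the decomposition: its `n`-dimensional simplices (as vertex sets). -/
def elements (𝒯 : SimplicialDecomposition Ω) : Set (Finset (EuclideanSpace ℝ (Fin n))) :=
  {s | s ∈ 𝒯.complex.faces ∧ s.card = n + 1}

/-- Shape regularity: each element `T` contains a ball of diameter `c₁ h_T` and is contained in a
ball of radius `C₁ h_T`. -/
def ShapeRegular (𝒯 : SimplicialDecomposition Ω) (c₁ C₁ : ℝ) : Prop :=
  ∀ s ∈ 𝒯.elements,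
    (∃ x, Metric.closedBall x (c₁ * simplexDiam s / 2) ⊆ simplexOf s) ∧
    (∃ y, simplexOf s ⊆ Metric.closedBall y (C₁ * simplexDiam s))

/-- The Lagrange finite element space of degree `k`: functions that are continuous on the closure
of `Ω` and coincide on each element with a polynomial of total degree at most `k`.
Values outside the closure of `Ω` are irrelevant. -/
def lagrangeSpace (𝒯 : SimplicialDecomposition Ω) (k : ℕ) :
    Submodule ℝ (EuclideanSpace ℝ (Fin n) → ℝ) where
  carrier := {v | ContinuousOn v (closure Ω) ∧ ∀ s ∈ 𝒯.elements,
    ∃ p : MvPolynomial (Fin n) ℝ, p.totalDegree ≤ k ∧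
      ∀ x ∈ simplexOf s, v x = MvPolynomial.eval (fun i => x i) p}
  zero_mem' := ⟨continuousOn_const, fun _ _ => ⟨0, by simp, by simp⟩⟩
  add_mem' := by
    rintro u v ⟨hu, hu'⟩ ⟨hv, hv'⟩
    refine ⟨hu.add hv, fun s hs => ?_⟩
    obtain ⟨p, hp, hp'⟩ := hu' s hs
    obtain ⟨q, hq, hq'⟩ := hv' s hs
    exact ⟨p + q, (MvPolynomial.totalDegree_add p q).trans (max_le hp hq),
      fun x hx => by simp [hp' x hx, hq' x hx]⟩
  smul_mem' := by
    rintro c v ⟨hv, hv'⟩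
    refine ⟨hv.const_smul c, fun s hs => ?_⟩
    obtain ⟨p, hp, hp'⟩ := hv' s hs
    exact ⟨c • p, (MvPolynomial.totalDegree_smul_le c p).trans hp,
      fun x hx => by simp [hp' x hx]⟩

/-- `η` is the Lagrange interpolant `I_h f` of degree `k`: it belongs to the finite element space
and takes the values of `f` at all Lagrange nodes (this determines `η` on the closure of `Ω`). -/
def IsLagrangeInterpolant (𝒯 : SimplicialDecomposition Ω) (k : ℕ)
    (f η : EuclideanSpace ℝ (Fin n) → ℝ) : Prop :=
  η ∈ 𝒯.lagrangeSpace k ∧ ∀ s ∈ 𝒯.elements, ∀ z ∈ lagrangeNodes k s, η z = f z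

end SimplicialDecomposition

/-- The norm `‖u‖_{L₂(U)}`. -/
noncomputable def l2Norm {n : ℕ} (u : EuclideanSpace ℝ (Fin n) → ℝ)
    (U : Set (EuclideanSpace ℝ (Fin n))) : ℝ≥0∞ :=
  eLpNorm u 2 (volume.restrict U)

/-- The seminorm `‖∇u‖_{L₂(U)}`, for `u` differentiable on the open set `U`. -/
noncomputable def gradL2Norm {n : ℕ} (u : EuclideanSpace ℝ (Fin n) → ℝ)
    (U : Set (EuclideanSpace ℝ (Fin n))) : ℝ≥0∞ :=
  eLpNorm (fun x => gradient u x) 2 (volume.restrict U)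

/-- The norm `‖u‖_{H¹(U)} = (∫_U u² + |∇u|²)^{1/2}`, for `u` continuously differentiable on the
open set `U` (so that the classical gradient is the weak one). -/
noncomputable def h1Norm {n : ℕ} (u : EuclideanSpace ℝ (Fin n) → ℝ)
    (U : Set (EuclideanSpace ℝ (Fin n))) : ℝ≥0∞ :=
  (l2Norm u U ^ 2 + gradL2Norm u U ^ 2) ^ (1 / 2 : ℝ)

/-- The seminorm `|u|_{W^j_∞(U)} = max_{|α| = j} ‖D^α u‖_{L_∞(U)}`, for `u` smooth on the open set
`U`. A partial derivative `D^α u` of order `j` is written as the derivative of order `j` in the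
directions `e_{i 0}, …, e_{i (j-1)}`. -/
noncomputable def wInftySeminorm {n : ℕ} (j : ℕ) (u : EuclideanSpace ℝ (Fin n) → ℝ)
    (U : Set (EuclideanSpace ℝ (Fin n))) : ℝ≥0∞ :=
  ⨆ i : Fin j → Fin n,
    eLpNorm (fun x => iteratedFDeriv ℝ j u x (fun l => EuclideanSpace.single (i l) (1 : ℝ)))
      ⊤ (volume.restrict U)

/-! Put `k = r - 1 ≥ 1`. On an element with interior `K`, diameter `h` and inner ball centred at
`x₀`, let `p` be the polynomial that equals `χ` there. The product `ω² p` is close to the polynomial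
`q(x) = ω(x₀)² p(x) + 2 ω(x₀) p(x₀) ∇ω(x₀)·(x - x₀)`, which has degree at most `k` and is therefore
reproduced by interpolation. So the error equals `g - I g` with `g = ω² p - q`.

Let `P` bound `|p|` and `G` bound `|ω(x₀)| |∇p|` on `K`. Taylor expansion of `ω` to second order
gives `|g| ≤ h N` and `|∇g| ≤ N`, where `N` is a constant times `(h/d) G + (h/d²) P`
(`localApprox_bounds`). Interpolation is stable in the maximum norm, and an inverse estimate
controls `∇(I g)`, so `g - I g` obeys the same bounds up to constants (`localInterpolant_error`).

It remains to pass to `L²`. By finite dimensionality and scaling (`exists_shape_regular_estimate`),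
`P |K|^{1/2}` and `G |K|^{1/2}` may be taken to be multiples of `‖p‖` and `‖ω(x₀)∇p‖`. Replacing
`ω(x₀)∇p` by `∇(ωp)` costs only a multiple of `‖p‖/d`, which the prefactor `h/d` turns into the
second term of the claim (`exists_element_estimate`). -/

/-! ### Polynomial functions of bounded degree: algebra, derivatives, unique continuation. -/

section PolynomialFunctions

/-- Evaluation of polynomials as functions on Euclidean space. -/
noncomputable def polyEval (n : ℕ) :
    MvPolynomial (Fin n) ℝ →ₗ[ℝ] (EuclideanSpace ℝ (Fin n) → ℝ) where
  toFun p x := MvPolynomial.eval (fun i => x i) p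
  map_add' p q := by ext x; simp
  map_smul' c p := by ext x; simp

/-- The space of polynomial functions of total degree at most `k` on `ℝⁿ`. -/
noncomputable def polyFun (n k : ℕ) : Submodule ℝ (EuclideanSpace ℝ (Fin n) → ℝ) :=
  (MvPolynomial.restrictTotalDegree (Fin n) ℝ k).map (polyEval n)

variable {n k l : ℕ}

instance : FiniteDimensional ℝ (polyFun n k) := by
  unfold polyFun; infer_instance

theorem mem_polyFun {u : EuclideanSpace ℝ (Fin n) → ℝ} :
    u ∈ polyFun n k ↔ ∃ p : MvPolynomial (Fin n) ℝ, p.totalDegree ≤ k ∧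
      ∀ x, u x = MvPolynomial.eval (fun i => x i) p := by
  simp only [polyFun, Submodule.mem_map, MvPolynomial.mem_restrictTotalDegree]
  refine exists_congr fun p => and_congr_right fun _ => ?_
  rw [funext_iff]
  exact forall_congr' fun x => eq_comm

theorem polyFun_mono (h : k ≤ l) : polyFun n k ≤ polyFun n l := by
  intro u hu
  obtain ⟨p, hp, hu⟩ := mem_polyFun.1 hu
  exact mem_polyFun.2 ⟨p, hp.trans h, hu⟩

theorem const_mem_polyFun (c : ℝ) : (fun _ => c) ∈ polyFun n k :=
  mem_polyFun.2 ⟨MvPolynomial.C c, by simp, by simp⟩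

theorem mul_mem_polyFun {u v : EuclideanSpace ℝ (Fin n) → ℝ} (hu : u ∈ polyFun n k)
    (hv : v ∈ polyFun n l) : (fun x => u x * v x) ∈ polyFun n (k + l) := by
  obtain ⟨p, hp, hu⟩ := mem_polyFun.1 hu
  obtain ⟨q, hq, hv⟩ := mem_polyFun.1 hv
  exact mem_polyFun.2 ⟨p * q, (MvPolynomial.totalDegree_mul _ _).trans (add_le_add hp hq),
    fun x => by simp [hu, hv]⟩

theorem prod_mem_polyFun {ι : Type*} (s : Finset ι) (m : ι → ℕ)
    (u : ι → EuclideanSpace ℝ (Fin n) → ℝ) (hu : ∀ i ∈ s, u i ∈ polyFun n (m i)) :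
    (fun x => ∏ i ∈ s, u i x) ∈ polyFun n (∑ i ∈ s, m i) := by
  classical
  induction s using Finset.induction_on with
  | empty => simpa using const_mem_polyFun 1
  | insert i s hi ih =>
    simp only [Finset.prod_insert hi, Finset.sum_insert hi]
    exact mul_mem_polyFun (hu i (by simp)) (ih fun j hj => hu j (by simp [hj]))

theorem linear_mem_polyFun (f : EuclideanSpace ℝ (Fin n) →ₗ[ℝ] ℝ) :
    (fun x => f x) ∈ polyFun n 1 := by
  refine mem_polyFun.2 ⟨∑ i, MvPolynomial.C (f (EuclideanSpace.single i 1)) * MvPolynomial.X i,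
    ?_, fun x => ?_⟩
  · refine MvPolynomial.totalDegree_finsetSum_le fun i _ => ?_
    refine (MvPolynomial.totalDegree_mul _ _).trans ?_
    simp
  · have hx : x = ∑ i, x i • EuclideanSpace.single i (1 : ℝ) := by
      ext j
      simp [Finset.sum_apply, Pi.single_apply]
    conv_lhs => rw [hx]
    simp [mul_comm]

theorem affine_mem_polyFun (f : EuclideanSpace ℝ (Fin n) →ᵃ[ℝ] ℝ) :
    (fun x => f x) ∈ polyFun n 1 := by
  rw [AffineMap.decomp f]
  exact Submodule.add_mem _ (linear_mem_polyFun f.linear) (const_mem_polyFun (f 0))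

theorem totalDegree_aeval_le {σ τ : Type*} (g : σ → MvPolynomial τ ℝ)
    (hg : ∀ i, (g i).totalDegree ≤ 1) (p : MvPolynomial σ ℝ) :
    (MvPolynomial.aeval g p).totalDegree ≤ p.totalDegree := by
  conv_lhs => rw [p.as_sum, map_sum]
  refine MvPolynomial.totalDegree_finsetSum_le fun m hm => ?_
  rw [MvPolynomial.aeval_monomial]
  refine (MvPolynomial.totalDegree_mul _ _).trans ?_
  rw [MvPolynomial.algebraMap_eq, MvPolynomial.totalDegree_C, zero_add]
  refine (MvPolynomial.totalDegree_finsetProd _ _).trans ?_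
  refine le_trans (Finset.sum_le_sum fun i _ => ?_) (MvPolynomial.le_totalDegree hm)
  refine (MvPolynomial.totalDegree_pow _ _).trans ?_
  exact (Nat.mul_le_mul_left _ (hg i)).trans (by simp)

theorem comp_affine_mem_polyFun {u : EuclideanSpace ℝ (Fin n) → ℝ} (hu : u ∈ polyFun n k)
    (f : EuclideanSpace ℝ (Fin n) →ᵃ[ℝ] EuclideanSpace ℝ (Fin n)) :
    (fun x => u (f x)) ∈ polyFun n k := by
  obtain ⟨p, hp, hu⟩ := mem_polyFun.1 hu
  have h (i : Fin n) : ∃ q : MvPolynomial (Fin n) ℝ, q.totalDegree ≤ 1 ∧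
      ∀ x, (f x) i = MvPolynomial.eval (fun i => x i) q :=
    mem_polyFun.1 (affine_mem_polyFun
      ((EuclideanSpace.proj i : EuclideanSpace ℝ (Fin n) →L[ℝ] ℝ).toLinearMap.toAffineMap.comp f))
  choose q hq hf using h
  refine mem_polyFun.2 ⟨MvPolynomial.aeval q p, (totalDegree_aeval_le q hq p).trans hp, fun x => ?_⟩
  rw [hu]
  simp only [hf]
  rw [MvPolynomial.aeval_def, MvPolynomial.eval, MvPolynomial.eval, MvPolynomial.hom_eval₂]
  simp

theorem totalDegree_pderiv_le {σ : Type*} (i : σ) (p : MvPolynomial σ ℝ) :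
    (MvPolynomial.pderiv i p).totalDegree ≤ p.totalDegree := by
  conv_lhs => rw [p.as_sum, map_sum]
  refine MvPolynomial.totalDegree_finsetSum_le fun m hm => ?_
  rw [MvPolynomial.pderiv_monomial]
  refine (MvPolynomial.totalDegree_monomial_le _ _).trans ?_
  refine le_trans ?_ (MvPolynomial.le_totalDegree hm)
  exact Finsupp.degree_mono (tsub_le_self (a := m) (b := Finsupp.single i 1))

theorem hasFDerivAt_eval (p : MvPolynomial (Fin n) ℝ) (x : EuclideanSpace ℝ (Fin n)) :
    HasFDerivAt (fun x : EuclideanSpace ℝ (Fin n) => MvPolynomial.eval (fun i => x i) p)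
      (∑ i, MvPolynomial.eval (fun i => x i) (MvPolynomial.pderiv i p) •
        (EuclideanSpace.proj i : EuclideanSpace ℝ (Fin n) →L[ℝ] ℝ)) x := by
  induction p using MvPolynomial.induction_on with
  | C a => simpa using hasFDerivAt_const a x
  | add p q hp hq =>
    simp only [map_add]
    refine (hp.add hq).congr_fderiv ?_
    simp only [add_smul, Finset.sum_add_distrib]
  | mul_X p j hp =>
    have hj : HasFDerivAt (fun x : EuclideanSpace ℝ (Fin n) => x j)
        (EuclideanSpace.proj j : EuclideanSpace ℝ (Fin n) →L[ℝ] ℝ) x :=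
      (EuclideanSpace.proj j : EuclideanSpace ℝ (Fin n) →L[ℝ] ℝ).hasFDerivAt
    have := hp.mul hj
    simp only [map_mul, MvPolynomial.eval_X]
    refine this.congr_fderiv ?_
    simp only [MvPolynomial.pderiv_mul, MvPolynomial.pderiv_X, map_add, map_mul,
      MvPolynomial.eval_X, add_smul, Finset.sum_add_distrib, Finset.smul_sum, smul_smul]
    rw [add_comm]
    congr 1
    · exact Finset.sum_congr rfl fun i _ => by rw [mul_comm]
    · rw [Finset.sum_eq_single j]
      · simp
      · intro i _ hij
        simp [hij.symm]
      · simp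

theorem contDiff_of_mem_polyFun {u : EuclideanSpace ℝ (Fin n) → ℝ} (hu : u ∈ polyFun n k)
    {m : WithTop ℕ∞} : ContDiff ℝ m u := by
  obtain ⟨p, -, hp⟩ := mem_polyFun.1 hu
  have h : u = fun x => MvPolynomial.eval (fun i => x i) p := funext hp
  rw [h]
  clear h hp hu
  induction p using MvPolynomial.induction_on with
  | C a => simpa using contDiff_const
  | add p q hp hq => simpa using hp.add hq
  | mul_X p j hp =>
    simp only [map_mul, MvPolynomial.eval_X]
    exact hp.mul
      (EuclideanSpace.proj j : EuclideanSpace ℝ (Fin n) →L[ℝ] ℝ).contDiff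

theorem fderiv_apply_mem_polyFun {u : EuclideanSpace ℝ (Fin n) → ℝ} (hu : u ∈ polyFun n k)
    (e : EuclideanSpace ℝ (Fin n)) : (fun x => fderiv ℝ u x e) ∈ polyFun n k := by
  obtain ⟨p, hp, hu⟩ := mem_polyFun.1 hu
  have h : u = fun x => MvPolynomial.eval (fun i => x i) p := funext hu
  refine mem_polyFun.2 ⟨∑ i, e i • MvPolynomial.pderiv i p, ?_, fun x => ?_⟩
  · refine MvPolynomial.totalDegree_finsetSum_le fun i _ => ?_
    exact (MvPolynomial.totalDegree_smul_le _ _).trans ((totalDegree_pderiv_le i p).trans hp)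
  · rw [h, (hasFDerivAt_eval p x).fderiv]
    simp [mul_comm]

/-- Polynomials are analytic, so the identity theorem on the connected space applies. This is what
makes the `L²` norm over a small ball a norm on polynomials. -/
theorem eq_zero_of_mem_polyFun_of_isOpen {u : EuclideanSpace ℝ (Fin n) → ℝ} (hu : u ∈ polyFun n k)
    {U : Set (EuclideanSpace ℝ (Fin n))} (hU : IsOpen U) (hne : U.Nonempty)
    (h : ∀ x ∈ U, u x = 0) : u = 0 := by
  obtain ⟨x₀, hx₀⟩ := hne
  have ha : AnalyticOnNhd ℝ u Set.univ := fun x _ =>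
    (contDiff_of_mem_polyFun hu (m := ⊤)).contDiffAt.analyticAt
  have := ha.eqOn_zero_of_preconnected_of_eventuallyEq_zero isPreconnected_univ (Set.mem_univ x₀)
    (Filter.eventually_of_mem (hU.mem_nhds hx₀) h)
  exact funext fun x => this (Set.mem_univ x)

end PolynomialFunctions

/-! ### Norm equivalence and inverse estimates for polynomials, with scaling. -/

section InverseEstimates

/-- On a finite-dimensional space every linear map is bounded by an injective one. -/
theorem exists_norm_le_of_injective {V X Y : Type*} [AddCommGroup V] [Module ℝ V]
    [FiniteDimensional ℝ V] [NormedAddCommGroup X] [NormedSpace ℝ X] [NormedAddCommGroup Y]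
    [NormedSpace ℝ Y] (F : V →ₗ[ℝ] X) (G : V →ₗ[ℝ] Y) (hF : Function.Injective F) :
    ∃ C : ℝ, 0 < C ∧ ∀ v, ‖G v‖ ≤ C * ‖F v‖ := by
  let e := LinearEquiv.ofInjective F hF
  -- The range of `F` is finite-dimensional, so `G ∘ F⁻¹` is automatically continuous on it.
  let L : LinearMap.range F →L[ℝ] Y := LinearMap.toContinuousLinearMap (G ∘ₗ e.symm.toLinearMap)
  refine ⟨‖L‖ + 1, by positivity, fun v => ?_⟩
  have h : L (e v) = G v := by simp [L]
  have h' : ‖e v‖ = ‖F v‖ := rfl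
  calc ‖G v‖ = ‖L (e v)‖ := by rw [h]
    _ ≤ ‖L‖ * ‖e v‖ := L.le_opNorm _
    _ ≤ (‖L‖ + 1) * ‖F v‖ := by rw [h']; gcongr; linarith

variable {n k : ℕ}

theorem memLp_ball_of_mem_polyFun {u : EuclideanSpace ℝ (Fin n) → ℝ} (hu : u ∈ polyFun n k)
    (x : EuclideanSpace ℝ (Fin n)) (ρ : ℝ) :
    MemLp u 2 (volume.restrict (Metric.ball x ρ)) := by
  have hc : Continuous u := (contDiff_of_mem_polyFun hu (m := 0)).continuous
  obtain ⟨M, hM⟩ := (isCompact_closedBall x ρ).exists_bound_of_continuousOn hc.continuousOn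
  have : IsFiniteMeasure (volume.restrict (Metric.ball x ρ)) :=
    ⟨by simpa using measure_ball_lt_top⟩
  refine MemLp.of_bound hc.aestronglyMeasurable M ?_
  filter_upwards [ae_restrict_mem measurableSet_ball] with y hy
  exact hM y (Metric.ball_subset_closedBall hy)

/-- Polynomials on a ball, as elements of `L²`. -/
noncomputable def polyToL2 (n k : ℕ) (ρ : ℝ) :
    polyFun n k →ₗ[ℝ] Lp ℝ 2 (volume.restrict (Metric.ball (0 : EuclideanSpace ℝ (Fin n)) ρ)) where
  toFun u := (memLp_ball_of_mem_polyFun u.2 0 ρ).toLp u.1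
  map_add' _ _ := rfl
  map_smul' _ _ := rfl

theorem polyToL2_injective {ρ : ℝ} (hρ : 0 < ρ) : Function.Injective (polyToL2 n k ρ) := by
  rw [← LinearMap.ker_eq_bot, LinearMap.ker_eq_bot']
  intro u hu
  have hc : Continuous u.1 := (contDiff_of_mem_polyFun u.2 (m := 0)).continuous
  have h0 : u.1 =ᵐ[volume.restrict (Metric.ball (0 : EuclideanSpace ℝ (Fin n)) ρ)] 0 :=
    (MemLp.toLp_eq_toLp_iff (memLp_ball_of_mem_polyFun u.2 0 ρ) MemLp.zero).1 hu
  have h1 := Measure.eqOn_open_of_ae_eq h0 Metric.isOpen_ball hc.continuousOn continuousOn_const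
  exact Subtype.ext (eq_zero_of_mem_polyFun_of_isOpen u.2 Metric.isOpen_ball
    ⟨0, Metric.mem_ball_self hρ⟩ fun x hx => h1 hx)

/-- All norms on the finite-dimensional polynomial space are comparable. Using concentric balls as
reference sets makes the constant independent of the shape of the element. -/
theorem exists_unit_ball_estimate (n k : ℕ) {ρ : ℝ} (hρ : 0 < ρ) :
    ∃ C : ℝ, 0 < C ∧ ∀ u ∈ polyFun n k,
      ∀ x ∈ Metric.closedBall (0 : EuclideanSpace ℝ (Fin n)) 1,
        |u x| ≤ C * (eLpNorm u 2 (volume.restrict (Metric.ball 0 ρ))).toReal ∧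
        ‖fderiv ℝ u x‖ ≤ C * (eLpNorm u 2 (volume.restrict (Metric.ball 0 ρ))).toReal := by
  let S := Metric.closedBall (0 : EuclideanSpace ℝ (Fin n)) 1
  have : CompactSpace S := isCompact_iff_compactSpace.1 (isCompact_closedBall _ _)
  have hcd (u : polyFun n k) : ContDiff ℝ 1 u.1 := contDiff_of_mem_polyFun u.2
  let G₀ : polyFun n k →ₗ[ℝ] C(S, ℝ) :=
    { toFun u := ⟨fun x => u.1 x, (hcd u).continuous.comp continuous_subtype_val⟩
      map_add' _ _ := rfl
      map_smul' _ _ := rfl }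
  let G₁ : polyFun n k →ₗ[ℝ] C(S, EuclideanSpace ℝ (Fin n) →L[ℝ] ℝ) :=
    { toFun u := ⟨fun x => fderiv ℝ u.1 x,
        ((hcd u).continuous_fderiv one_ne_zero).comp continuous_subtype_val⟩
      map_add' u v := by
        ext1 x
        exact fderiv_add ((hcd u).differentiable one_ne_zero _)
          ((hcd v).differentiable one_ne_zero _)
      map_smul' c u := by
        ext1 x
        exact fderiv_const_smul ((hcd u).differentiable one_ne_zero _) c }
  obtain ⟨C₀, hC₀, h₀⟩ := exists_norm_le_of_injective (polyToL2 n k ρ) G₀ (polyToL2_injective hρ)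
  obtain ⟨C₁, hC₁, h₁⟩ := exists_norm_le_of_injective
    (Y := C(S, EuclideanSpace ℝ (Fin n) →L[ℝ] ℝ)) (polyToL2 n k ρ) G₁ (polyToL2_injective hρ)
  refine ⟨max C₀ C₁, by positivity, fun u hu x hx => ?_⟩
  have hn : ‖polyToL2 n k ρ ⟨u, hu⟩‖
      = (eLpNorm u 2 (volume.restrict (Metric.ball 0 ρ))).toReal :=
    Lp.norm_toLp u (memLp_ball_of_mem_polyFun hu 0 ρ)
  rw [← hn]
  constructor
  · refine ((G₀ ⟨u, hu⟩).norm_coe_le_norm ⟨x, hx⟩).trans ((h₀ _).trans ?_)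
    gcongr
    exact le_max_left _ _
  · refine ((G₁ ⟨u, hu⟩).norm_coe_le_norm ⟨x, hx⟩).trans ((h₁ _).trans ?_)
    gcongr
    exact le_max_right _ _

theorem eLpNorm_comp_homothety {u : EuclideanSpace ℝ (Fin n) → ℝ} (hu : Continuous u)
    (x₀ : EuclideanSpace ℝ (Fin n)) {h : ℝ} (hh : 0 < h) (ρ : ℝ) :
    eLpNorm (fun z => u (x₀ + h • z)) 2 (volume.restrict (Metric.ball 0 ρ))
      = ENNReal.ofReal ((h ^ n)⁻¹) ^ (1 / 2 : ℝ)
        * eLpNorm u 2 (volume.restrict (Metric.ball x₀ (ρ * h))) := by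
  have hmeas : Measurable fun z : EuclideanSpace ℝ (Fin n) => x₀ + h • z := by fun_prop
  have hmap : Measure.map (fun z : EuclideanSpace ℝ (Fin n) => x₀ + h • z) volume
      = ENNReal.ofReal ((h ^ n)⁻¹) • volume := by
    have h1 : (fun z : EuclideanSpace ℝ (Fin n) => x₀ + h • z) = (x₀ + ·) ∘ (h • ·) := rfl
    rw [h1, ← Measure.map_map (by fun_prop) (by fun_prop), Measure.map_addHaar_smul _ hh.ne',
      Measure.map_smul, map_add_left_eq_self, finrank_euclideanSpace_fin,
      abs_of_pos (by positivity)]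
  have hpre : (fun z : EuclideanSpace ℝ (Fin n) => x₀ + h • z) ⁻¹' Metric.ball x₀ (ρ * h)
      = Metric.ball 0 ρ := by
    ext z
    simp only [Set.mem_preimage, Metric.mem_ball, dist_self_add_left, dist_zero_right, norm_smul,
      Real.norm_eq_abs, abs_of_pos hh]
    rw [mul_comm, mul_lt_mul_iff_left₀ hh]
  have hr := Measure.restrict_map hmeas (measurableSet_ball (x := x₀) (ε := ρ * h)) (μ := volume)
  rw [hmap, hpre] at hr
  have := eLpNorm_map_measure (p := 2) (μ := volume.restrict (Metric.ball 0 ρ))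
    (f := fun z : EuclideanSpace ℝ (Fin n) => x₀ + h • z) hu.aestronglyMeasurable hmeas.aemeasurable
  rw [← hr, Measure.restrict_smul, eLpNorm_smul_measure_of_ne_top (by simp)] at this
  rw [smul_eq_mul] at this
  simpa [Function.comp_def] using this.symm

/-- Scaled norm equivalence and inverse estimate for polynomials on a set which is comparable to a
ball. -/
theorem exists_shape_regular_estimate (n k : ℕ) {ρ : ℝ} (hρ : 0 < ρ) :
    ∃ C : ℝ, 0 < C ∧ ∀ u ∈ polyFun n k, ∀ (x₀ : EuclideanSpace ℝ (Fin n)) (h : ℝ), 0 < h →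
      ∀ K : Set (EuclideanSpace ℝ (Fin n)), Metric.ball x₀ (ρ * h) ⊆ K →
        K ⊆ Metric.closedBall x₀ h → ∀ x ∈ Metric.closedBall x₀ h,
        ENNReal.ofReal |u x| * volume K ^ (1 / 2 : ℝ)
            ≤ ENNReal.ofReal C * eLpNorm u 2 (volume.restrict K) ∧
        ENNReal.ofReal (h * ‖fderiv ℝ u x‖) * volume K ^ (1 / 2 : ℝ)
            ≤ ENNReal.ofReal C * eLpNorm u 2 (volume.restrict K) := by
  obtain ⟨C, hC, hB⟩ := exists_unit_ball_estimate n k hρ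
  let b := volume (Metric.closedBall (0 : EuclideanSpace ℝ (Fin n)) 1)
  have hb : b ^ (1 / 2 : ℝ) ≠ ⊤ :=
    ENNReal.rpow_ne_top_of_nonneg (by norm_num) measure_closedBall_lt_top.ne
  have hb0 : 0 < (b ^ (1 / 2 : ℝ)).toReal := by
    refine ENNReal.toReal_pos ?_ hb
    have : b ≠ 0 := (Metric.measure_closedBall_pos _ _ one_pos).ne'
    simp [ENNReal.rpow_eq_zero_iff, this]
  -- The factor `b^{1/2}` comes from `|K| ≤ hⁿ b`; the power `h^{n/2}` cancels the one produced by
  -- rescaling to the unit ball.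
  refine ⟨C * (b ^ (1 / 2 : ℝ)).toReal, by positivity, fun u hu x₀ h hh K hK hK' x hx => ?_⟩
  have hc : ContDiff ℝ 1 u := contDiff_of_mem_polyFun hu
  let v : EuclideanSpace ℝ (Fin n) → ℝ := fun z => u (x₀ + h • z)
  have hv : v ∈ polyFun n k := by
    have := comp_affine_mem_polyFun hu
      (AffineMap.const ℝ (EuclideanSpace ℝ (Fin n)) x₀ +
        h • AffineMap.id ℝ (EuclideanSpace ℝ (Fin n)))
    simpa [v] using this
  let z := h⁻¹ • (x - x₀)
  have hz : x₀ + h • z = x := by simp [z, smul_smul, hh.ne']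
  have hz1 : z ∈ Metric.closedBall (0 : EuclideanSpace ℝ (Fin n)) 1 := by
    rw [mem_closedBall_zero_iff, norm_smul, norm_inv, Real.norm_eq_abs, abs_of_pos hh,
      inv_mul_le_iff₀ hh, mul_one]
    exact mem_closedBall_iff_norm.1 hx
  have hdv : fderiv ℝ v z = h • fderiv ℝ u x := by
    have h1 : HasFDerivAt (fun z : EuclideanSpace ℝ (Fin n) => x₀ + h • z)
        (h • ContinuousLinearMap.id ℝ (EuclideanSpace ℝ (Fin n))) z :=
      ((hasFDerivAt_id z).const_smul h).const_add x₀
    have h2 : HasFDerivAt u (fderiv ℝ u x) (x₀ + h • z) := by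
      rw [hz]; exact (hc.differentiable one_ne_zero x).hasFDerivAt
    refine (h2.comp z h1).fderiv.trans ?_
    ext y
    simp
  obtain ⟨e1, e2⟩ := hB v hv z hz1
  have hvz : v z = u x := by simp only [v]; rw [hz]
  rw [hvz] at e1
  rw [hdv, norm_smul, Real.norm_eq_abs, abs_of_pos hh] at e2
  have key : ∀ t : ℝ,
      t ≤ C * (eLpNorm v 2 (volume.restrict (Metric.ball 0 ρ))).toReal →
      ENNReal.ofReal t * volume K ^ (1 / 2 : ℝ)
        ≤ ENNReal.ofReal (C * (b ^ (1 / 2 : ℝ)).toReal) * eLpNorm u 2 (volume.restrict K) := by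
    intro t ht
    have hvN : eLpNorm v 2 (volume.restrict (Metric.ball 0 ρ)) ≠ ⊤ :=
      (memLp_ball_of_mem_polyFun hv 0 ρ).2.ne
    have h1 : ENNReal.ofReal t
        ≤ ENNReal.ofReal C * eLpNorm v 2 (volume.restrict (Metric.ball 0 ρ)) := by
      refine (ENNReal.ofReal_le_ofReal ht).trans ?_
      rw [ENNReal.ofReal_mul hC.le, ENNReal.ofReal_toReal hvN]
    have h2 : eLpNorm v 2 (volume.restrict (Metric.ball 0 ρ))
        ≤ ENNReal.ofReal ((h ^ n)⁻¹) ^ (1 / 2 : ℝ) * eLpNorm u 2 (volume.restrict K) := by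
      rw [eLpNorm_comp_homothety hc.continuous x₀ hh ρ]
      gcongr
    have h3 : volume K ≤ ENNReal.ofReal (h ^ n) * b := by
      refine (measure_mono hK').trans ?_
      rw [Measure.addHaar_closedBall' _ _ hh.le, finrank_euclideanSpace_fin]
    have h4 : ENNReal.ofReal ((h ^ n)⁻¹) ^ (1 / 2 : ℝ) * volume K ^ (1 / 2 : ℝ)
        ≤ b ^ (1 / 2 : ℝ) := by
      rw [← ENNReal.mul_rpow_of_nonneg _ _ (by norm_num)]
      gcongr
      calc ENNReal.ofReal ((h ^ n)⁻¹) * volume K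
          ≤ ENNReal.ofReal ((h ^ n)⁻¹) * (ENNReal.ofReal (h ^ n) * b) := by gcongr
        _ = b := by
          rw [← mul_assoc, ← ENNReal.ofReal_mul (by positivity),
            inv_mul_cancel₀ (by positivity)]
          simp
    calc ENNReal.ofReal t * volume K ^ (1 / 2 : ℝ)
        ≤ (ENNReal.ofReal C * (ENNReal.ofReal ((h ^ n)⁻¹) ^ (1 / 2 : ℝ) *
            eLpNorm u 2 (volume.restrict K))) * volume K ^ (1 / 2 : ℝ) := by
          gcongr
          exact h1.trans (by gcongr)
      _ = ENNReal.ofReal C * (ENNReal.ofReal ((h ^ n)⁻¹) ^ (1 / 2 : ℝ) *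
            volume K ^ (1 / 2 : ℝ)) * eLpNorm u 2 (volume.restrict K) := by ring
      _ ≤ ENNReal.ofReal C * b ^ (1 / 2 : ℝ) * eLpNorm u 2 (volume.restrict K) := by gcongr
      _ = _ := by rw [ENNReal.ofReal_mul hC.le, ENNReal.ofReal_toReal hb]
  exact ⟨key _ e1, key _ e2⟩

end InverseEstimates

/-! ### The explicit Lagrange interpolation formula in barycentric coordinates. -/

section LagrangeSum

variable {n : ℕ}

/-- The univariate factor `t (t - 1) ⋯ (t - m + 1) / m!` of the Lagrange basis functions. -/
noncomputable def lagrangeFactor (t : ℝ) (m : ℕ) : ℝ :=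
  ∏ i ∈ Finset.range m, (t - i) / (i + 1)

theorem lagrangeFactor_natCast_self (m : ℕ) : lagrangeFactor m m = 1 := by
  have h : ∏ i ∈ Finset.range m, ((m : ℝ) - i) = ∏ i ∈ Finset.range m, ((i : ℝ) + 1) := by
    rw [← Finset.prod_range_reflect]
    refine Finset.prod_congr rfl fun i hi => ?_
    have hi' : i + 1 ≤ m := Finset.mem_range.1 hi
    rw [Nat.sub_sub, Nat.cast_sub (by omega)]
    push_cast
    ring
  rw [lagrangeFactor, Finset.prod_div_distrib, h, div_self]
  exact Finset.prod_ne_zero_iff.2 fun i _ => by positivity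

theorem lagrangeFactor_natCast_of_lt {j m : ℕ} (h : j < m) : lagrangeFactor j m = 0 :=
  Finset.prod_eq_zero (Finset.mem_range.2 h) (by simp)

theorem lagrangeFactor_zero_left {m : ℕ} (h : m ≠ 0) : lagrangeFactor 0 m = 0 := by
  simpa using lagrangeFactor_natCast_of_lt (j := 0) (Nat.pos_of_ne_zero h)

/-- Each factor satisfies `|t - i| ≤ K (i + 1)`, because `t` and `i` both lie in `[0, K]`. -/
theorem abs_lagrangeFactor_le {t K : ℝ} (m : ℕ) (ht : 0 ≤ t) (htK : t ≤ K) (hm : (m : ℝ) ≤ K) :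
    |lagrangeFactor t m| ≤ K ^ m := by
  rw [lagrangeFactor, Finset.abs_prod]
  refine (Finset.prod_le_prod (fun i _ => abs_nonneg _) (g := fun _ => K) fun i hi => ?_).trans
    (by simp)
  have hi' : (i : ℝ) ≤ K :=
    le_trans (by exact_mod_cast (Finset.mem_range.1 hi).le) hm
  have hK : 0 ≤ K := ht.trans htK
  rw [abs_div, abs_of_pos (by positivity : (0 : ℝ) < i + 1), div_le_iff₀ (by positivity)]
  have hKi : 0 ≤ K * i := by positivity
  have hi0 : (0 : ℝ) ≤ i := by positivity
  rw [abs_le]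
  constructor <;> nlinarith

open Classical in
/-- The Lagrange interpolant of degree `k` on the simplex with vertices `s`, evaluated at the point
with barycentric coordinates `w`. -/
noncomputable def lagrangeSum (k : ℕ) (s : Finset (EuclideanSpace ℝ (Fin n)))
    (f : EuclideanSpace ℝ (Fin n) → ℝ) (w : EuclideanSpace ℝ (Fin n) → ℝ) : ℝ :=
  ∑ a ∈ s.piAntidiag k, f (∑ v ∈ s, ((a v : ℝ) / (k : ℝ)) • v) *
    ∏ v ∈ s, lagrangeFactor (k * w v) (a v)

variable {k : ℕ} {s u : Finset (EuclideanSpace ℝ (Fin n))}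
  {f w : EuclideanSpace ℝ (Fin n) → ℝ}

theorem lagrangeSum_congr {w' : EuclideanSpace ℝ (Fin n) → ℝ} (h : ∀ v ∈ s, w v = w' v) :
    lagrangeSum k s f w = lagrangeSum k s f w' := by
  refine Finset.sum_congr rfl fun a _ => ?_
  congr 1
  exact Finset.prod_congr rfl fun v hv => by rw [h v hv]

/-- The values of the interpolant on a face only depend on the data on that face. -/
theorem lagrangeSum_of_subset (hu : u ⊆ s) (hw : ∀ v ∈ s, v ∉ u → w v = 0) :
    lagrangeSum k s f w = lagrangeSum k u f w := by
  classical
  unfold lagrangeSum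
  symm
  refine Finset.sum_subset_zero_on_sdiff ?_ ?_ ?_
  · intro a ha
    rw [Finset.mem_piAntidiag] at ha ⊢
    refine ⟨?_, fun v hv => hu (ha.2 v hv)⟩
    rw [← ha.1]
    exact (Finset.sum_subset hu fun v _ hv => by_contra fun h => hv (ha.2 v h)).symm
  · intro a ha
    rw [Finset.mem_sdiff, Finset.mem_piAntidiag, Finset.mem_piAntidiag] at ha
    obtain ⟨⟨h1, h2⟩, h3⟩ := ha
    -- A multi-index not supported on the face has a positive entry at a vertex where the coordinate
    -- is zero, so its basis function vanishes on the face.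
    have : ∃ v ∈ s, v ∉ u ∧ a v ≠ 0 := by
      by_contra! hcon
      have hsub : ∀ v, a v ≠ 0 → v ∈ u := fun v hv =>
        by_contra fun hvu => hv (hcon v (h2 v hv) hvu)
      refine h3 ⟨?_, hsub⟩
      rw [← h1]
      exact Finset.sum_subset hu fun v _ hv => by_contra fun h => hv (hsub v h)
    obtain ⟨v, hvs, hvu, hav⟩ := this
    rw [Finset.prod_eq_zero hvs, mul_zero]
    rw [hw v hvs hvu, mul_zero, lagrangeFactor_zero_left hav]
  · intro a ha
    rw [Finset.mem_piAntidiag] at ha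
    have h0 : ∀ v ∈ s, v ∉ u → a v = 0 := fun v _ hv => by_contra fun h => hv (ha.2 v h)
    congr 1
    · congr 1
      exact Finset.sum_subset hu fun v hv hvu => by simp [h0 v hv hvu]
    · exact Finset.prod_subset hu fun v hv hvu => by simp [h0 v hv hvu, lagrangeFactor]

/-- The interpolant takes the prescribed values at the nodes. -/
theorem lagrangeSum_node (hk : k ≠ 0) {a : EuclideanSpace ℝ (Fin n) → ℕ}
    (ha : ∑ v ∈ s, a v = k) (hw : ∀ v ∈ s, w v = (a v : ℝ) / k) :
    lagrangeSum k s f w = f (∑ v ∈ s, ((a v : ℝ) / (k : ℝ)) • v) := by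
  classical
  have hk' : (k : ℝ) ≠ 0 := Nat.cast_ne_zero.2 hk
  have hkw : ∀ v ∈ s, (k : ℝ) * w v = a v := fun v hv => by rw [hw v hv]; field_simp
  -- Elements of `piAntidiag` must vanish off `s`, while `a` is arbitrary there; hence the
  -- truncation.
  let a' : EuclideanSpace ℝ (Fin n) → ℕ := fun v => if v ∈ s then a v else 0
  have haa' : ∀ v ∈ s, a' v = a v := fun v hv => by simp [a', hv]
  have ha' : a' ∈ s.piAntidiag k := by
    rw [Finset.mem_piAntidiag]
    refine ⟨by rw [← ha]; exact Finset.sum_congr rfl haa', fun v hv => ?_⟩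
    by_contra hvs
    exact hv (by simp [a', hvs])
  rw [lagrangeSum, Finset.sum_eq_single_of_mem a' ha']
  · rw [Finset.prod_eq_one fun v hv => by rw [hkw v hv, haa' v hv, lagrangeFactor_natCast_self],
      mul_one]
    congr 1
    exact Finset.sum_congr rfl fun v hv => by rw [haa' v hv]
  · intro b hb hba
    rw [Finset.mem_piAntidiag] at hb
    -- Two distinct multi-indices with the same total: the second exceeds the first somewhere, and
    -- there the factor has a root at the node.
    have : ∃ v ∈ s, a v < b v := by
      by_contra! hcon
      have heq := (Finset.sum_eq_sum_iff_of_le hcon).1 (hb.1.trans ha.symm)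
      refine hba (funext fun v => ?_)
      by_cases hv : v ∈ s
      · rw [heq v hv, haa' v hv]
      · have : b v = 0 := by_contra fun h => hv (hb.2 v h)
        simp [a', hv, this]
    obtain ⟨v, hv, hlt⟩ := this
    rw [Finset.prod_eq_zero hv, mul_zero]
    rw [hkw v hv, lagrangeFactor_natCast_of_lt hlt]

open Classical in
theorem card_piAntidiag_le (s : Finset (EuclideanSpace ℝ (Fin n))) (k : ℕ) :
    (s.piAntidiag k).card ≤ (k + 1) ^ s.card := by
  have : (s.piAntidiag k).card ≤ (s.pi fun _ => Finset.range (k + 1)).card := by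
    refine Finset.card_le_card_of_injOn (fun a v _ => a v) ?_ ?_
    · intro a ha
      rw [Finset.mem_coe, Finset.mem_piAntidiag] at ha
      refine Finset.mem_pi.2 fun v hv => Finset.mem_range.2 ?_
      have := Finset.single_le_sum (f := a) (fun _ _ => Nat.zero_le _) hv
      exact Nat.lt_succ_of_le (this.trans ha.1.le)
    · intro a ha b hb hab
      rw [Finset.mem_coe, Finset.mem_piAntidiag] at ha hb
      refine funext fun v => ?_
      by_cases hv : v ∈ s
      · exact congrFun (congrFun hab v) hv
      · rw [by_contra fun h => hv (ha.2 v h), by_contra fun h => hv (hb.2 v h)]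
  simpa using this

/-- Stability of interpolation in the maximum norm. -/
theorem abs_lagrangeSum_le {M : ℝ} (hM : 0 ≤ M) (hw : ∀ v ∈ s, 0 ≤ w v ∧ w v ≤ 1)
    (hf : ∀ z ∈ lagrangeNodes k s, |f z| ≤ M) :
    |lagrangeSum k s f w| ≤ ((k : ℝ) + 1) ^ s.card * (k : ℝ) ^ k * M := by
  classical
  have hterm : ∀ a ∈ s.piAntidiag k, |f (∑ v ∈ s, ((a v : ℝ) / (k : ℝ)) • v) *
      ∏ v ∈ s, lagrangeFactor (k * w v) (a v)| ≤ M * (k : ℝ) ^ k := by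
    intro a ha
    rw [Finset.mem_piAntidiag] at ha
    rw [abs_mul, Finset.abs_prod]
    have h1 := hf _ ⟨a, ha.1, rfl⟩
    have h2 : ∏ v ∈ s, |lagrangeFactor (k * w v) (a v)| ≤ (k : ℝ) ^ k := by
      calc ∏ v ∈ s, |lagrangeFactor (k * w v) (a v)| ≤ ∏ v ∈ s, (k : ℝ) ^ a v := by
            refine Finset.prod_le_prod (fun v _ => abs_nonneg _) fun v hv => ?_
            obtain ⟨h0, h1⟩ := hw v hv
            refine abs_lagrangeFactor_le _ (by positivity) ?_ ?_
            · exact mul_le_of_le_one_right (by positivity) h1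
            · have := Finset.single_le_sum (f := a) (fun _ _ => Nat.zero_le _) hv
              exact_mod_cast this.trans ha.1.le
        _ = (k : ℝ) ^ k := by rw [Finset.prod_pow_eq_pow_sum, ha.1]
    exact mul_le_mul h1 h2 (Finset.prod_nonneg fun v _ => abs_nonneg _) ((abs_nonneg _).trans h1)
  refine (Finset.abs_sum_le_sum_abs _ _).trans ((Finset.sum_le_sum hterm).trans ?_)
  rw [Finset.sum_const, nsmul_eq_mul]
  have hc : ((s.piAntidiag k).card : ℝ) ≤ ((k : ℝ) + 1) ^ s.card := by
    exact_mod_cast card_piAntidiag_le s k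
  calc _ ≤ ((k : ℝ) + 1) ^ s.card * (M * (k : ℝ) ^ k) := by gcongr
    _ = _ := by ring

end LagrangeSum

/-! ### Barycentric coordinates, the local interpolant and unisolvence. -/

section Barycentric

variable {n k : ℕ} {s u : Finset (EuclideanSpace ℝ (Fin n))}

/-- `lam v`, for `v ∈ s`, are the barycentric coordinates of the nondegenerate simplex with
vertices `s`. -/
structure IsBarycentric (s : Finset (EuclideanSpace ℝ (Fin n)))
    (lam : EuclideanSpace ℝ (Fin n) → EuclideanSpace ℝ (Fin n) →ᵃ[ℝ] ℝ) : Prop where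
  apply_self : ∀ v ∈ s, lam v v = 1
  apply_ne : ∀ v ∈ s, ∀ w ∈ s, w ≠ v → lam v w = 0
  sum_eq_one : ∀ x, ∑ v ∈ s, lam v x = 1
  sum_smul : ∀ x, ∑ v ∈ s, lam v x • v = x

theorem exists_isBarycentric
    (hs : AffineIndependent ℝ ((↑) : s → EuclideanSpace ℝ (Fin n))) (hc : s.card = n + 1) :
    ∃ lam, IsBarycentric s lam := by
  classical
  obtain ⟨b, hb⟩ : ∃ b : AffineBasis s ℝ (EuclideanSpace ℝ (Fin n)), ∀ i : s, b i = i :=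
    ⟨⟨(↑), hs, by
      rw [hs.affineSpan_eq_top_iff_card_eq_finrank_add_one]
      simpa using hc⟩, fun _ => rfl⟩
  obtain ⟨lam, hlam⟩ : ∃ lam : EuclideanSpace ℝ (Fin n) → EuclideanSpace ℝ (Fin n) →ᵃ[ℝ] ℝ,
      ∀ i : s, lam i = b.coord i :=
    ⟨fun v => if h : v ∈ s then b.coord ⟨v, h⟩ else 0, fun i => dif_pos i.2⟩
  refine ⟨lam, fun v hv => ?_, fun v hv w hw hwv => ?_, fun x => ?_, fun x => ?_⟩
  · have h := b.coord_apply_eq ⟨v, hv⟩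
    rwa [← hlam, hb] at h
  · have : (⟨v, hv⟩ : s) ≠ ⟨w, hw⟩ := fun h => hwv (congrArg Subtype.val h).symm
    have h := b.coord_apply_ne this
    rwa [← hlam, hb] at h
  · have h := b.sum_coord_apply_eq_one x
    simp only [← hlam] at h
    exact (Finset.sum_coe_sort s fun v => lam v x).symm.trans h
  · have h := b.linear_combination_coord_eq_self x
    simp only [← hlam, hb] at h
    exact (Finset.sum_coe_sort s fun v => lam v x • v).symm.trans h

open Classical in
/-- Barycentric coordinates with respect to the vertices `s`. -/
noncomputable def baryCoord (s : Finset (EuclideanSpace ℝ (Fin n))) :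
    EuclideanSpace ℝ (Fin n) → EuclideanSpace ℝ (Fin n) →ᵃ[ℝ] ℝ :=
  if h : ∃ lam, IsBarycentric s lam then h.choose else 0

theorem isBarycentric_baryCoord
    (hs : AffineIndependent ℝ ((↑) : s → EuclideanSpace ℝ (Fin n))) (hc : s.card = n + 1) :
    IsBarycentric s (baryCoord s) := by
  have h := exists_isBarycentric hs hc
  rw [baryCoord, dif_pos h]
  exact h.choose_spec

theorem affineMap_sum_smul (f : EuclideanSpace ℝ (Fin n) →ᵃ[ℝ] ℝ) {w : EuclideanSpace ℝ (Fin n) → ℝ}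
    (hw : ∑ v ∈ u, w v = 1) : f (∑ v ∈ u, w v • v) = ∑ v ∈ u, w v * f v := by
  have hf : ∀ x, f x = f.linear x + f 0 := fun x => congrFun f.decomp x
  have h1 : ∑ v ∈ u, w v * f v = ∑ v ∈ u, w v * f.linear v + ∑ v ∈ u, w v * f 0 := by
    rw [← Finset.sum_add_distrib]
    exact Finset.sum_congr rfl fun v _ => by rw [hf v, mul_add]
  rw [hf, h1, map_sum, ← Finset.sum_mul, hw, one_mul]
  simp

namespace IsBarycentric

variable {lam : EuclideanSpace ℝ (Fin n) → EuclideanSpace ℝ (Fin n) →ᵃ[ℝ] ℝ}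

theorem apply_sum_of_mem (h : IsBarycentric s lam) (hu : u ⊆ s) {w : EuclideanSpace ℝ (Fin n) → ℝ}
    (hw : ∑ v ∈ u, w v = 1) {v : EuclideanSpace ℝ (Fin n)} (hv : v ∈ u) :
    lam v (∑ y ∈ u, w y • y) = w v := by
  rw [affineMap_sum_smul _ hw, Finset.sum_eq_single_of_mem v hv, h.apply_self v (hu hv), mul_one]
  intro y hy hyv
  rw [h.apply_ne v (hu hv) y (hu hy) hyv, mul_zero]

theorem apply_sum_of_notMem (h : IsBarycentric s lam) (hu : u ⊆ s)
    {w : EuclideanSpace ℝ (Fin n) → ℝ} (hw : ∑ v ∈ u, w v = 1) {v : EuclideanSpace ℝ (Fin n)}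
    (hv : v ∈ s) (hvu : v ∉ u) : lam v (∑ y ∈ u, w y • y) = 0 := by
  rw [affineMap_sum_smul _ hw]
  refine Finset.sum_eq_zero fun y hy => ?_
  rw [h.apply_ne v hv y (hu hy) fun e => hvu (e ▸ hy), mul_zero]

theorem mem_Icc (h : IsBarycentric s lam) {x : EuclideanSpace ℝ (Fin n)} (hx : x ∈ simplexOf s)
    {v : EuclideanSpace ℝ (Fin n)} (hv : v ∈ s) : 0 ≤ lam v x ∧ lam v x ≤ 1 := by
  obtain ⟨w, hw0, hw1, rfl⟩ := Finset.mem_convexHull'.1 hx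
  rw [h.apply_sum_of_mem subset_rfl hw1 hv]
  exact ⟨hw0 v hv, hw1 ▸ Finset.single_le_sum hw0 hv⟩

theorem apply_node (h : IsBarycentric s lam) (hk : k ≠ 0) {a : EuclideanSpace ℝ (Fin n) → ℕ}
    (ha : ∑ v ∈ s, a v = k) {v : EuclideanSpace ℝ (Fin n)} (hv : v ∈ s) :
    lam v (∑ y ∈ s, ((a y : ℝ) / (k : ℝ)) • y) = (a v : ℝ) / k := by
  refine h.apply_sum_of_mem subset_rfl (w := fun v => (a v : ℝ) / k) ?_ hv
  rw [← Finset.sum_div, ← Nat.cast_sum, ha, div_self (Nat.cast_ne_zero.2 hk)]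

end IsBarycentric

theorem lagrangeNodes_subset (hk : k ≠ 0) : lagrangeNodes k s ⊆ simplexOf s := by
  rintro z ⟨a, ha, rfl⟩
  refine Finset.mem_convexHull'.2 ⟨fun v => (a v : ℝ) / k, fun v _ => by positivity, ?_, rfl⟩
  rw [← Finset.sum_div, ← Nat.cast_sum, ha, div_self (Nat.cast_ne_zero.2 hk)]

/-- The Lagrange interpolant of degree `k` on the simplex with vertices `s`. -/
noncomputable def localInterpolant (k : ℕ) (s : Finset (EuclideanSpace ℝ (Fin n)))
    (f : EuclideanSpace ℝ (Fin n) → ℝ) : EuclideanSpace ℝ (Fin n) → ℝ :=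
  fun x => lagrangeSum k s f fun v => baryCoord s v x

theorem lagrangeFactor_affine_mem_polyFun (f : EuclideanSpace ℝ (Fin n) →ᵃ[ℝ] ℝ) (k m : ℕ) :
    (fun x => lagrangeFactor (k * f x) m) ∈ polyFun n m := by
  have h := prod_mem_polyFun (n := n) (Finset.range m) (fun _ => 1)
    (fun i x => ((k : ℝ) * f x - i) / (i + 1)) fun i _ => by
      have h1 := (polyFun n 1).smul_mem (((i : ℝ) + 1)⁻¹)
        ((polyFun n 1).sub_mem ((polyFun n 1).smul_mem (k : ℝ) (affine_mem_polyFun f))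
          (const_mem_polyFun (i : ℝ)))
      convert h1 using 1
      ext x
      simp [div_eq_inv_mul]
  simpa [lagrangeFactor] using h

/-- The factor at the vertex `v` has degree at most `a v` in an affine function, and the entries of
`a` add up to `k`. -/
theorem localInterpolant_mem_polyFun (f : EuclideanSpace ℝ (Fin n) → ℝ) :
    localInterpolant k s f ∈ polyFun n k := by
  classical
  have : localInterpolant k s f = ∑ a ∈ s.piAntidiag k,
      f (∑ v ∈ s, ((a v : ℝ) / (k : ℝ)) • v) •
        fun x => ∏ v ∈ s, lagrangeFactor (k * baryCoord s v x) (a v) := by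
    ext x
    simp [localInterpolant, lagrangeSum, Finset.sum_apply]
  rw [this]
  refine Submodule.sum_mem _ fun a ha => Submodule.smul_mem _ _ ?_
  have h := prod_mem_polyFun (n := n) s a (fun v x => lagrangeFactor (k * baryCoord s v x) (a v))
    fun v _ => lagrangeFactor_affine_mem_polyFun _ _ _
  rwa [(Finset.mem_piAntidiag.1 ha).1] at h

theorem localInterpolant_node (hs : IsBarycentric s (baryCoord s)) (hk : k ≠ 0)
    (f : EuclideanSpace ℝ (Fin n) → ℝ) {z : EuclideanSpace ℝ (Fin n)}
    (hz : z ∈ lagrangeNodes k s) : localInterpolant k s f z = f z := by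
  obtain ⟨a, ha, rfl⟩ := hz
  exact lagrangeSum_node hk ha fun v hv => hs.apply_node hk ha hv

theorem abs_localInterpolant_le (hs : IsBarycentric s (baryCoord s)) (hc : s.card = n + 1)
    {f : EuclideanSpace ℝ (Fin n) → ℝ} {M : ℝ} (hM : 0 ≤ M)
    (hf : ∀ z ∈ lagrangeNodes k s, |f z| ≤ M) {x : EuclideanSpace ℝ (Fin n)}
    (hx : x ∈ simplexOf s) :
    |localInterpolant k s f x| ≤ ((k : ℝ) + 1) ^ (n + 1) * (k : ℝ) ^ k * M := by
  rw [← hc]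
  exact abs_lagrangeSum_le hM (fun v hv => hs.mem_Icc hx hv) hf

/-- The interpolants on two simplices agree on a common face. -/
theorem localInterpolant_eq_of_mem_inter {s t : Finset (EuclideanSpace ℝ (Fin n))}
    (hs : IsBarycentric s (baryCoord s)) (ht : IsBarycentric t (baryCoord t))
    (f : EuclideanSpace ℝ (Fin n) → ℝ) {x : EuclideanSpace ℝ (Fin n)}
    (hx : x ∈ convexHull ℝ ((s : Set (EuclideanSpace ℝ (Fin n))) ∩ t)) :
    localInterpolant k s f x = localInterpolant k t f x := by
  classical
  rw [← Finset.coe_inter] at hx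
  obtain ⟨w, hw0, hw1, rfl⟩ := Finset.mem_convexHull'.1 hx
  have hus : s ∩ t ⊆ s := Finset.inter_subset_left
  have hut : s ∩ t ⊆ t := Finset.inter_subset_right
  unfold localInterpolant
  rw [lagrangeSum_of_subset hus fun v hv hvu => hs.apply_sum_of_notMem hus hw1 hv hvu,
    lagrangeSum_of_subset hut fun v hv hvu => ht.apply_sum_of_notMem hut hw1 hv hvu]
  refine lagrangeSum_congr fun v hv => ?_
  rw [hs.apply_sum_of_mem hus hw1 hv, ht.apply_sum_of_mem hut hw1 hv]

/-- A polynomial of degree at most `k` that vanishes at the points of the simplex lattice of order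
`k` is zero. -/
theorem eq_zero_of_eval_lattice_eq_zero {σ : Type*} [Fintype σ] {p : MvPolynomial σ ℝ}
    (hp : p.totalDegree ≤ k)
    (h : ∀ a : σ → ℕ, ∑ i, a i ≤ k → MvPolynomial.eval (fun i => (a i : ℝ)) p = 0) : p = 0 := by
  classical
  by_contra hp0
  obtain ⟨t, ht, htd⟩ := Finset.exists_mem_eq_sup p.support (MvPolynomial.support_nonempty.2 hp0)
    fun m => m.sum fun _ e => e
  have htd' : p.totalDegree = t.degree := htd
  -- The combinatorial Nullstellensatz for a top-degree monomial `t` gives a nonzero value on the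
  -- grid `∏ {0, …, t i}`. Its points have coordinate sum at most `t.degree ≤ k`, so they belong to
  -- the lattice.
  obtain ⟨x, hx, hxp⟩ := MvPolynomial.combinatorial_nullstellensatz_exists_eval_nonzero p t
    (MvPolynomial.mem_support_iff.1 ht) htd'
    (fun i => (Finset.range (t i + 1)).image (Nat.cast : ℕ → ℝ)) fun i => by
      rw [Finset.card_image_of_injective _ Nat.cast_injective]
      simp
  have hx' : ∀ i, ∃ a : ℕ, a ≤ t i ∧ (a : ℝ) = x i := by
    intro i
    obtain ⟨a, ha, hax⟩ := Finset.mem_image.1 (hx i)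
    exact ⟨a, Nat.lt_succ_iff.1 (Finset.mem_range.1 ha), hax⟩
  choose a ha hax using hx'
  refine hxp ?_
  rw [← funext hax]
  refine h a ((Finset.sum_le_sum fun i _ => ha i).trans ?_)
  rw [← Finsupp.degree_eq_sum, ← htd']
  exact hp

/-- Unisolvence of the Lagrange nodes. -/
theorem eq_zero_of_forall_lagrangeNodes (hs : IsBarycentric s (baryCoord s)) (hk : k ≠ 0)
    {u : EuclideanSpace ℝ (Fin n) → ℝ} (hu : u ∈ polyFun n k)
    (h : ∀ z ∈ lagrangeNodes k s, u z = 0) : u = 0 := by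
  classical
  obtain ⟨p, hp, hup⟩ := mem_polyFun.1 hu
  have hk' : (k : ℝ) ≠ 0 := Nat.cast_ne_zero.2 hk
  have hne : s.Nonempty := by
    by_contra hcon
    rw [Finset.not_nonempty_iff_eq_empty] at hcon
    simpa [hcon] using hs.sum_eq_one 0
  obtain ⟨v₀, hv₀⟩ := hne
  let σ := s.erase v₀
  -- The affine chart whose coordinates are `k` times the barycentric coordinates at the vertices
  -- other than `v₀`; it turns the nodes into the integer lattice.
  let g : Fin n → MvPolynomial σ ℝ := fun i =>
    MvPolynomial.C (v₀ i) + ∑ v : σ, MvPolynomial.C ((v.1 i - v₀ i) / k) * MvPolynomial.X v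
  have hg : ∀ i, (g i).totalDegree ≤ 1 := by
    intro i
    refine (MvPolynomial.totalDegree_add _ _).trans (max_le (by simp) ?_)
    refine MvPolynomial.totalDegree_finsetSum_le fun v _ => ?_
    exact (MvPolynomial.totalDegree_mul _ _).trans (by simp)
  have heval : ∀ y : EuclideanSpace ℝ (Fin n) → ℝ, ∑ v ∈ s, y v = k →
      MvPolynomial.eval (fun v : σ => y v) (MvPolynomial.aeval g p)
        = u (∑ v ∈ s, (y v / k) • v) := by
    intro y hy
    have e : MvPolynomial.eval (fun v : σ => y v) (MvPolynomial.aeval g p)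
        = MvPolynomial.eval (fun i => MvPolynomial.eval (fun v : σ => y v) (g i)) p := by
      rw [MvPolynomial.aeval_def, MvPolynomial.eval, MvPolynomial.eval, MvPolynomial.hom_eval₂]
      simp
    rw [e, hup]
    congr 2
    ext i
    have h1 : y v₀ / k = 1 - ∑ v ∈ s.erase v₀, y v / k := by
      rw [← Finset.add_sum_erase s y hv₀] at hy
      rw [← Finset.sum_div, eq_sub_iff_add_eq, ← add_div, hy, div_self hk']
    have h2 : (∑ v ∈ s, (y v / k) • v) i
        = y v₀ / k * v₀ i + ∑ v ∈ s.erase v₀, y v / k * v i := by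
      rw [← Finset.add_sum_erase s _ hv₀]
      simp
    rw [h2, h1]
    simp only [g, map_add, MvPolynomial.eval_C, map_sum, map_mul, MvPolynomial.eval_X]
    rw [Finset.sum_coe_sort (s.erase v₀) fun v => (v i - v₀ i) / k * y v, sub_mul, one_mul,
      Finset.sum_mul, sub_add, ← Finset.sum_sub_distrib, sub_eq_add_neg, ← Finset.sum_neg_distrib]
    congr 1
    exact Finset.sum_congr rfl fun v _ => by ring
  have hP : MvPolynomial.aeval g p = 0 := by
    refine eq_zero_of_eval_lattice_eq_zero ((totalDegree_aeval_le g hg p).trans hp) fun a ha => ?_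
    -- The entry at `v₀` is the remainder that makes the total `k`; the natural subtraction is exact
    -- since `∑ a ≤ k`.
    let a' : EuclideanSpace ℝ (Fin n) → ℕ := fun v =>
      if hv : v ∈ σ then a ⟨v, hv⟩ else k - ∑ i, a i
    have hsum : ∑ v ∈ s, a' v = k := by
      rw [← Finset.add_sum_erase s a' hv₀, ← Finset.sum_coe_sort (s.erase v₀)]
      have h1 : ∑ v : σ, a' v = ∑ i, a i := Finset.sum_congr rfl fun v _ => by simp [a']
      have h2 : a' v₀ = k - ∑ i, a i := by simp [a', σ]
      rw [h1, h2]
      omega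
    have := heval (fun v => (a' v : ℝ)) (by exact_mod_cast hsum)
    rw [h _ ⟨a', hsum, rfl⟩] at this
    simpa [a'] using this
  refine funext fun x => ?_
  have := heval (fun v => k * baryCoord s v x)
    (by rw [← Finset.mul_sum, hs.sum_eq_one, mul_one])
  rw [hP, map_zero] at this
  have hx : ∑ v ∈ s, ((k : ℝ) * baryCoord s v x / k) • v = x := by
    refine Eq.trans (Finset.sum_congr rfl fun v _ => ?_) (hs.sum_smul x)
    rw [mul_div_cancel_left₀ _ hk']
  rw [hx] at this
  exact this.symm

/-- The difference is a polynomial of degree at most `k` vanishing at all nodes, so unisolvence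
applies. -/
theorem localInterpolant_of_mem_polyFun (hs : IsBarycentric s (baryCoord s)) (hk : k ≠ 0)
    {q : EuclideanSpace ℝ (Fin n) → ℝ} (hq : q ∈ polyFun n k) : localInterpolant k s q = q := by
  have := eq_zero_of_forall_lagrangeNodes hs hk
    ((polyFun n k).sub_mem (localInterpolant_mem_polyFun (s := s) q) hq) fun z hz => by
      simp [localInterpolant_node hs hk q hz]
  exact sub_eq_zero.1 this

theorem localInterpolant_sub (f g : EuclideanSpace ℝ (Fin n) → ℝ) :
    localInterpolant k s (fun x => f x - g x)
      = fun x => localInterpolant k s f x - localInterpolant k s g x := by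
  ext x
  simp [localInterpolant, lagrangeSum, sub_mul, Finset.sum_sub_distrib]

end Barycentric

/-! ### Gluing the local interpolants over the mesh. -/

section GlobalInterpolant

theorem isCompact_simplexOf {n : ℕ} (s : Finset (EuclideanSpace ℝ (Fin n))) :
    IsCompact (simplexOf s) :=
  s.finite_toSet.isCompact_convexHull ℝ

theorem convex_simplexOf {n : ℕ} (s : Finset (EuclideanSpace ℝ (Fin n))) :
    Convex ℝ (simplexOf s) :=
  convex_convexHull ℝ _

theorem localInterpolant_congr {n k : ℕ} {s : Finset (EuclideanSpace ℝ (Fin n))}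
    {f g : EuclideanSpace ℝ (Fin n) → ℝ} (h : ∀ z ∈ lagrangeNodes k s, f z = g z) :
    localInterpolant k s f = localInterpolant k s g := by
  classical
  ext x
  refine Finset.sum_congr rfl fun a ha => ?_
  rw [h _ ⟨a, (Finset.mem_piAntidiag.1 ha).1, rfl⟩]

namespace SimplicialDecomposition

variable {n : ℕ} {Ω : Set (EuclideanSpace ℝ (Fin n))} (𝒯 : SimplicialDecomposition Ω)

theorem isBarycentric_of_mem_elements {s : Finset (EuclideanSpace ℝ (Fin n))}
    (hs : s ∈ 𝒯.elements) : IsBarycentric s (baryCoord s) :=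
  isBarycentric_baryCoord (𝒯.complex.indep hs.1) hs.2

theorem simplexOf_subset_closure {s : Finset (EuclideanSpace ℝ (Fin n))}
    (hs : s ∈ 𝒯.elements) : simplexOf s ⊆ closure Ω := by
  rw [← 𝒯.space_eq]
  exact 𝒯.complex.convexHull_subset_space hs.1

theorem finite_elements : 𝒯.elements.Finite :=
  𝒯.finite_faces.subset fun _ hs => hs.1

theorem closure_eq_iUnion : closure Ω = ⋃ s : 𝒯.elements, simplexOf s.1 := by
  refine Set.Subset.antisymm (fun x hx => ?_)
    (Set.iUnion_subset fun s => 𝒯.simplexOf_subset_closure s.2)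
  rw [← 𝒯.space_eq, Geometry.SimplicialComplex.mem_space_iff] at hx
  obtain ⟨s, hs, hxs⟩ := hx
  obtain ⟨t, ht, hst, htc⟩ := 𝒯.pure s hs
  exact Set.mem_iUnion.2 ⟨⟨t, ht, htc⟩, convexHull_mono (Finset.coe_subset.2 hst) hxs⟩

theorem isCompact_closure (𝒯 : SimplicialDecomposition Ω) : IsCompact (closure Ω) := by
  have := 𝒯.finite_elements.to_subtype
  rw [𝒯.closure_eq_iUnion]
  exact isCompact_iUnion fun s => isCompact_simplexOf s.1

theorem simplexDiam_le_diam {s : Finset (EuclideanSpace ℝ (Fin n))} (hs : s ∈ 𝒯.elements) :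
    simplexDiam s ≤ Metric.diam Ω := by
  rw [← Metric.diam_closure]
  exact Metric.diam_mono (𝒯.simplexOf_subset_closure hs) 𝒯.isCompact_closure.isBounded

theorem simplexDiam_pos (hn : 1 ≤ n) {s : Finset (EuclideanSpace ℝ (Fin n))}
    (hs : s ∈ 𝒯.elements) : 0 < simplexDiam s := by
  have hc : 1 < s.card := by rw [hs.2]; omega
  obtain ⟨v, hv, w, hw, hvw⟩ := Finset.one_lt_card.1 hc
  refine (dist_pos.2 hvw).trans_le
    (Metric.dist_le_diam_of_mem (isCompact_simplexOf s).isBounded ?_ ?_)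
  · exact subset_convexHull ℝ _ hv
  · exact subset_convexHull ℝ _ hw

/-- The Lagrange interpolant exists, and is given on each element by the local one. -/
theorem exists_isLagrangeInterpolant {k : ℕ} (hk : k ≠ 0) (f : EuclideanSpace ℝ (Fin n) → ℝ) :
    ∃ η, 𝒯.IsLagrangeInterpolant k f η ∧
      ∀ s ∈ 𝒯.elements, ∀ x ∈ simplexOf s, η x = localInterpolant k s f x := by
  classical
  let η : EuclideanSpace ℝ (Fin n) → ℝ := fun x =>
    if h : ∃ s ∈ 𝒯.elements, x ∈ simplexOf s then localInterpolant k h.choose f x else 0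
  have hη : ∀ s ∈ 𝒯.elements, ∀ x ∈ simplexOf s, η x = localInterpolant k s f x := by
    intro s hs x hx
    have h : ∃ s ∈ 𝒯.elements, x ∈ simplexOf s := ⟨s, hs, hx⟩
    simp only [η, dif_pos h]
    -- By conformity the intersection of two elements lies in the hull of their common vertices, so
    -- the arbitrarily chosen element does not affect the value.
    exact localInterpolant_eq_of_mem_inter (𝒯.isBarycentric_of_mem_elements h.choose_spec.1)
      (𝒯.isBarycentric_of_mem_elements hs) f
      (𝒯.complex.inter_subset_convexHull h.choose_spec.1.1 hs.1 ⟨h.choose_spec.2, hx⟩)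
  refine ⟨η, ⟨⟨?_, fun s hs => ?_⟩, fun s hs z hz => ?_⟩, hη⟩
  · have := 𝒯.finite_elements.to_subtype
    rw [𝒯.closure_eq_iUnion]
    -- Continuity on each member of a finite closed cover suffices.
    refine (locallyFinite_of_finite _).continuousOn_iUnion
      (fun s => (isCompact_simplexOf s.1).isClosed) fun s => ?_
    exact ((contDiff_of_mem_polyFun (localInterpolant_mem_polyFun f)
      (m := 0)).continuous.continuousOn).congr (hη s.1 s.2)
  · obtain ⟨p, hp, hpe⟩ := mem_polyFun.1 (localInterpolant_mem_polyFun (k := k) (s := s) f)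
    exact ⟨p, hp, fun x hx => by rw [hη s hs x hx, hpe]⟩
  · rw [hη s hs z (lagrangeNodes_subset hk hz),
      localInterpolant_node (𝒯.isBarycentric_of_mem_elements hs) hk f hz]

end SimplicialDecomposition

end GlobalInterpolant

/-! ### From essential bounds on partial derivatives to pointwise operator norms. -/

section SeminormBounds

variable {n : ℕ}

theorem norm_le_of_norm_single_le {F : Type*} [NormedAddCommGroup F] [NormedSpace ℝ F]
    (L : EuclideanSpace ℝ (Fin n) →L[ℝ] F) {a : ℝ} (ha : 0 ≤ a)
    (h : ∀ i, ‖L (EuclideanSpace.single i 1)‖ ≤ a) : ‖L‖ ≤ n * a := by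
  refine L.opNorm_le_bound (by positivity) fun x => ?_
  have hx : x = ∑ i, x i • EuclideanSpace.single i (1 : ℝ) := by
    ext j
    simp [Finset.sum_apply, Pi.single_apply]
  calc ‖L x‖ = ‖∑ i, x i • L (EuclideanSpace.single i 1)‖ := by
        conv_lhs => rw [hx]
        simp
    _ ≤ ∑ i, ‖x i • L (EuclideanSpace.single i 1)‖ := norm_sum_le _ _
    _ ≤ ∑ _i : Fin n, ‖x‖ * a := by
        refine Finset.sum_le_sum fun i _ => ?_
        rw [norm_smul]
        exact mul_le_mul (PiLp.norm_apply_le x i) (h i) (norm_nonneg _) (norm_nonneg _)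
    _ = n * a * ‖x‖ := by simp; ring

theorem abs_iteratedFDeriv_le_of_wInftySeminorm_le {Ω : Set (EuclideanSpace ℝ (Fin n))}
    (hΩ : IsOpen Ω) {ω : EuclideanSpace ℝ (Fin n) → ℝ}
    (hω : ContDiffOn ℝ ((⊤ : ℕ∞) : WithTop ℕ∞) ω Ω) {j : ℕ} {a : ℝ} (ha : 0 ≤ a)
    (h : wInftySeminorm j ω Ω ≤ ENNReal.ofReal a) (i : Fin j → Fin n)
    {x : EuclideanSpace ℝ (Fin n)} (hx : x ∈ Ω) :
    |iteratedFDeriv ℝ j ω x fun l => EuclideanSpace.single (i l) (1 : ℝ)| ≤ a := by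
  let g : EuclideanSpace ℝ (Fin n) → ℝ := fun x =>
    iteratedFDeriv ℝ j ω x fun l => EuclideanSpace.single (i l) (1 : ℝ)
  have hg : ContinuousOn g Ω := by
    have h1 : ContinuousOn (iteratedFDerivWithin ℝ j ω Ω) Ω :=
      hω.continuousOn_iteratedFDerivWithin (by exact_mod_cast le_top) hΩ.uniqueDiffOn
    have h2 : ContinuousOn (iteratedFDeriv ℝ j ω) Ω :=
      h1.congr fun y hy => (iteratedFDerivWithin_of_isOpen j hΩ hy).symm
    exact fun y hy => (h2 y hy).eval_const _
  have hae : ∀ᵐ y ∂volume.restrict Ω, ‖g y‖ ≤ a := by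
    have h1 : eLpNorm g ⊤ (volume.restrict Ω) ≤ ENNReal.ofReal a :=
      (le_iSup (fun i : Fin j → Fin n => eLpNorm (fun x => iteratedFDeriv ℝ j ω x
        (fun l => EuclideanSpace.single (i l) (1 : ℝ))) ⊤ (volume.restrict Ω)) i).trans h
    rw [eLpNorm_exponent_top] at h1
    filter_upwards [enorm_ae_le_eLpNormEssSup g (volume.restrict Ω)] with y hy
    have := hy.trans h1
    rwa [← ofReal_norm, ENNReal.ofReal_le_ofReal_iff ha] at this
  -- Both sides are continuous and agree almost everywhere on an open set, hence everywhere on it;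
  -- this removes the exceptional null set.
  have hmin : (fun y => min ‖g y‖ a) =ᵐ[volume.restrict Ω] fun y => ‖g y‖ := by
    filter_upwards [hae] with y hy using min_eq_left hy
  have := Measure.eqOn_open_of_ae_eq hmin hΩ (hg.norm.inf continuousOn_const) hg.norm hx
  exact min_eq_left_iff.1 this

/-- Pointwise bounds for a cutoff function and its first two derivatives. -/
theorem bounds_of_wInftySeminorm_le {Ω : Set (EuclideanSpace ℝ (Fin n))} (hn : 1 ≤ n)
    (hΩ : IsOpen Ω) {ω : EuclideanSpace ℝ (Fin n) → ℝ}
    (hω : ContDiffOn ℝ ((⊤ : ℕ∞) : WithTop ℕ∞) ω Ω) {A d : ℝ} (hA : 0 < A) (hd : 0 < d)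
    (h : ∀ j ≤ 2, wInftySeminorm j ω Ω ≤ ENNReal.ofReal (A * (d ^ j)⁻¹))
    {x : EuclideanSpace ℝ (Fin n)} (hx : x ∈ Ω) :
    |ω x| ≤ n ^ 2 * A ∧ ‖fderiv ℝ ω x‖ ≤ n ^ 2 * A / d ∧
      ‖fderiv ℝ (fderiv ℝ ω) x‖ ≤ n ^ 2 * A / d ^ 2 := by
  have hn' : (1 : ℝ) ≤ n := by exact_mod_cast hn
  have key (j : ℕ) (hj : j ≤ 2) (i : Fin j → Fin n) :=
    abs_iteratedFDeriv_le_of_wInftySeminorm_le hΩ hω (by positivity) (h j hj) i hx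
  refine ⟨?_, ?_, ?_⟩
  · have := key 0 (by norm_num) Fin.elim0
    simp only [iteratedFDeriv_zero_apply, pow_zero, inv_one, mul_one] at this
    exact this.trans (le_mul_of_one_le_left hA.le (one_le_pow₀ hn'))
  · have h1 : ‖fderiv ℝ ω x‖ ≤ n * (A * (d ^ 1)⁻¹) := by
      refine norm_le_of_norm_single_le _ (by positivity) fun i => ?_
      have := key 1 (by norm_num) fun _ => i
      rwa [iteratedFDeriv_one_apply] at this
    refine h1.trans ?_
    rw [pow_one, ← mul_assoc, ← div_eq_mul_inv]
    gcongr
    nlinarith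
  -- Each slot of the bilinear form costs a factor `n`. The resulting `n² A` also covers the lower
  -- orders because `n ≥ 1`.
  · have h1 : ‖fderiv ℝ (fderiv ℝ ω) x‖ ≤ n * (n * (A * (d ^ 2)⁻¹)) := by
      refine norm_le_of_norm_single_le _ (by positivity) fun i => ?_
      refine norm_le_of_norm_single_le _ (by positivity) fun j => ?_
      have := key 2 le_rfl ![i, j]
      rwa [iteratedFDeriv_two_apply] at this
    refine h1.trans (le_of_eq ?_)
    field_simp

end SeminormBounds

/-! ### Local polynomial approximation of `ω² p`. -/

section PointwiseEstimate

variable {n k : ℕ}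

/-- Taylor estimates on a convex open set of size `h`. -/
theorem taylor_bounds {K : Set (EuclideanSpace ℝ (Fin n))} (hK : IsOpen K) (hKc : Convex ℝ K)
    {ω : EuclideanSpace ℝ (Fin n) → ℝ} (hω : ContDiffOn ℝ 2 ω K) {B d h : ℝ} (hB : 0 ≤ B)
    (hd : 0 < d) (hh : 0 ≤ h) (h1 : ∀ x ∈ K, ‖fderiv ℝ ω x‖ ≤ B / d)
    (h2 : ∀ x ∈ K, ‖fderiv ℝ (fderiv ℝ ω) x‖ ≤ B / d ^ 2) {x₀ x : EuclideanSpace ℝ (Fin n)}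
    (hx₀ : x₀ ∈ K) (hx : x ∈ K) (hball : ∀ x ∈ K, ‖x - x₀‖ ≤ h) :
    |ω x - ω x₀| ≤ B / d * h ∧ ‖fderiv ℝ ω x - fderiv ℝ ω x₀‖ ≤ B / d ^ 2 * h ∧
      |ω x - ω x₀ - fderiv ℝ ω x₀ (x - x₀)| ≤ B / d ^ 2 * h * h := by
  have hdiff : ∀ x ∈ K, DifferentiableAt ℝ ω x := fun x hx =>
    (hω.contDiffAt (hK.mem_nhds hx)).differentiableAt (by norm_num)
  have hdiff' : ∀ x ∈ K, DifferentiableAt ℝ (fderiv ℝ ω) x := fun x hx =>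
    ((hω.contDiffAt (hK.mem_nhds hx)).fderiv_right (m := 1) (by norm_num)).differentiableAt
      (by norm_num)
  have hD : ∀ x ∈ K, ‖fderiv ℝ ω x - fderiv ℝ ω x₀‖ ≤ B / d ^ 2 * h := fun x hx =>
    (hKc.norm_image_sub_le_of_norm_fderiv_le hdiff' h2 hx₀ hx).trans
      (mul_le_mul_of_nonneg_left (hball x hx) (by positivity))
  refine ⟨?_, hD x hx, ?_⟩
  · exact (hKc.norm_image_sub_le_of_norm_fderiv_le hdiff h1 hx₀ hx).trans
      (mul_le_mul_of_nonneg_left (hball x hx) (by positivity))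
  -- The mean value inequality for `ω` minus its linearisation at `x₀`, whose derivative is at most
  -- `B / d ^ 2 * h`.
  · exact (hKc.norm_image_sub_le_of_norm_fderiv_le' hdiff hD hx₀ hx).trans
      (mul_le_mul_of_nonneg_left (hball x hx) (by positivity))

/-- The polynomial that approximates `ω² p` near `x₀`. -/
noncomputable def localApprox (ω p : EuclideanSpace ℝ (Fin n) → ℝ)
    (x₀ : EuclideanSpace ℝ (Fin n)) : EuclideanSpace ℝ (Fin n) → ℝ :=
  -- Freezing `ω²` at `x₀` alone would leave a gradient error of order `P/d`, short of a factor
  -- `h/d`. The second term removes it; its coefficient uses `p x₀` instead of `p x` to keep the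
  -- degree at most `k`.
  fun x => ω x₀ ^ 2 * p x + 2 * ω x₀ * p x₀ * fderiv ℝ ω x₀ (x - x₀)

theorem localApprox_mem_polyFun (hk : k ≠ 0) (ω : EuclideanSpace ℝ (Fin n) → ℝ)
    {p : EuclideanSpace ℝ (Fin n) → ℝ} (hp : p ∈ polyFun n k) (x₀ : EuclideanSpace ℝ (Fin n)) :
    localApprox ω p x₀ ∈ polyFun n k := by
  have h1 : (fun x => fderiv ℝ ω x₀ (x - x₀)) ∈ polyFun n k := by
    refine polyFun_mono (Nat.one_le_iff_ne_zero.2 hk) ?_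
    have := (polyFun n 1).sub_mem (linear_mem_polyFun (fderiv ℝ ω x₀).toLinearMap)
      (const_mem_polyFun (fderiv ℝ ω x₀ x₀))
    convert this using 1
    ext x
    simp
  exact (polyFun n k).add_mem ((polyFun n k).smul_mem (ω x₀ ^ 2) hp)
    ((polyFun n k).smul_mem (2 * ω x₀ * p x₀) h1)

/-- `ω² p - q` is small in `C¹`, where `q` is the approximating polynomial. -/
theorem localApprox_bounds {K : Set (EuclideanSpace ℝ (Fin n))} (hK : IsOpen K)
    (hKc : Convex ℝ K) {ω p : EuclideanSpace ℝ (Fin n) → ℝ} (hω : ContDiffOn ℝ 2 ω K)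
    (hp : ContDiff ℝ 1 p) {B d h P G c : ℝ} (hB : 0 ≤ B) (hd : 0 < d) (hh : 0 ≤ h)
    (hP : 0 ≤ P) (hG : 0 ≤ G) (hc : 0 ≤ c)
    (h0 : ∀ x ∈ K, |ω x| ≤ B) (h1 : ∀ x ∈ K, ‖fderiv ℝ ω x‖ ≤ B / d)
    (h2 : ∀ x ∈ K, ‖fderiv ℝ (fderiv ℝ ω) x‖ ≤ B / d ^ 2) {x₀ x : EuclideanSpace ℝ (Fin n)}
    (hx₀ : x₀ ∈ K) (hx : x ∈ K) (hball : ∀ x ∈ K, ‖x - x₀‖ ≤ h)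
    (hpP : ∀ x ∈ K, |p x| ≤ P) (hpc : ∀ x ∈ K, h * ‖fderiv ℝ p x‖ ≤ c * P)
    (hpG : ∀ x ∈ K, |ω x₀| * ‖fderiv ℝ p x‖ ≤ G) :
    |ω x ^ 2 * p x - localApprox ω p x₀ x|
        ≤ h * ((4 * B + (8 + c) * B ^ 2) * (h / d * G + h / d ^ 2 * P)) ∧
      ‖fderiv ℝ (fun x => ω x ^ 2 * p x - localApprox ω p x₀ x) x‖
        ≤ (4 * B + (8 + c) * B ^ 2) * (h / d * G + h / d ^ 2 * P) := by
  obtain ⟨t1, t2, t3⟩ := taylor_bounds hK hKc hω hB hd hh h1 h2 hx₀ hx hball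
  have hpd : ∀ x, DifferentiableAt ℝ p x := fun x => hp.differentiable one_ne_zero x
  have hωd : DifferentiableAt ℝ ω x :=
    (hω.contDiffAt (hK.mem_nhds hx)).differentiableAt (by norm_num)
  have hpp : |p x - p x₀| ≤ 2 * P := by
    have := abs_sub (p x) (p x₀)
    linarith [hpP x hx, hpP x₀ hx₀]
  -- Keeping the weight `ω x₀` on increments of `p` yields `G` rather than an unweighted bound on
  -- `∇p`.
  have hωp : |ω x₀| * |p x - p x₀| ≤ h * G := by
    have e : |ω x₀ * p x - ω x₀ * p x₀| ≤ G * ‖x - x₀‖ := by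
      refine hKc.norm_image_sub_le_of_norm_fderiv_le (𝕜 := ℝ) (f := fun x => ω x₀ * p x)
        (fun y _ => (hpd y).const_mul _) (fun y hy => ?_) hx₀ hx
      rw [fderiv_const_mul (hpd y), norm_smul]
      exact hpG y hy
    rw [← abs_mul, mul_sub, mul_comm h]
    exact e.trans (mul_le_mul_of_nonneg_left (hball x hx) hG)
  have b0 := h0 x₀ hx₀
  have bD := h1 x hx
  have bp0 := hpP x₀ hx₀
  have bpc := hpc x hx
  have bpG := hpG x hx
  have e0 : 0 ≤ h / d * G := by positivity
  have e1 : 0 ≤ h / d ^ 2 * P := by positivity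
  have e2 : 0 ≤ c * B ^ 2 := by positivity
  -- The numbers 2, 5 and, below, 4, `8 + c` result from collecting terms in the value and gradient
  -- estimates; a single constant dominates both.
  have hfin : 2 * B * (h / d * G) + 5 * B ^ 2 * (h / d ^ 2 * P)
      ≤ (4 * B + (8 + c) * B ^ 2) * (h / d * G + h / d ^ 2 * P) := by
    nlinarith [mul_nonneg hB e0, mul_nonneg hB e1, mul_nonneg (sq_nonneg B) e0,
      mul_nonneg (sq_nonneg B) e1, mul_nonneg e2 e0, mul_nonneg e2 e1]
  have hfin' : 4 * B * (h / d * G) + (8 + c) * B ^ 2 * (h / d ^ 2 * P)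
      ≤ (4 * B + (8 + c) * B ^ 2) * (h / d * G + h / d ^ 2 * P) := by
    nlinarith [mul_nonneg hB e0, mul_nonneg hB e1, mul_nonneg (sq_nonneg B) e0,
      mul_nonneg (sq_nonneg B) e1, mul_nonneg e2 e0, mul_nonneg e2 e1]
  constructor
  · have e : ω x ^ 2 * p x - localApprox ω p x₀ x
        = (ω x - ω x₀) * (2 * (ω x₀ * (p x - p x₀)) + (ω x - ω x₀) * (p x - p x₀))
          + ((ω x - ω x₀) * (ω x - ω x₀)
            + 2 * (ω x₀ * (ω x - ω x₀ - fderiv ℝ ω x₀ (x - x₀)))) * p x₀ := by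
      simp only [localApprox]
      ring
    calc |ω x ^ 2 * p x - localApprox ω p x₀ x|
        ≤ |ω x - ω x₀| * (2 * (|ω x₀| * |p x - p x₀|) + |ω x - ω x₀| * |p x - p x₀|)
          + (|ω x - ω x₀| * |ω x - ω x₀|
            + 2 * (|ω x₀| * |ω x - ω x₀ - fderiv ℝ ω x₀ (x - x₀)|)) * |p x₀| := by
          rw [e]
          refine (abs_add_le _ _).trans (add_le_add ?_ ?_)
          · rw [abs_mul]
            refine mul_le_mul_of_nonneg_left ((abs_add_le _ _).trans (le_of_eq ?_)) (abs_nonneg _)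
            simp only [abs_mul, abs_two]
          · rw [abs_mul]
            refine mul_le_mul_of_nonneg_right ((abs_add_le _ _).trans (le_of_eq ?_)) (abs_nonneg _)
            simp only [abs_mul, abs_two]
      _ ≤ B / d * h * (2 * (h * G) + B / d * h * (2 * P))
          + (B / d * h * (B / d * h) + 2 * (B * (B / d ^ 2 * h * h))) * P := by gcongr
      _ = h * (2 * B * (h / d * G) + 5 * B ^ 2 * (h / d ^ 2 * P)) := by
          field_simp
          ring
      _ ≤ _ := mul_le_mul_of_nonneg_left hfin hh
  -- The gradient is grouped so that every summand contains a small difference: of `p`, of `ω²`, of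
  -- `ω` or of `∇ω` between `x` and `x₀`.
  · have hder : HasFDerivAt (fun x => ω x ^ 2 * p x - localApprox ω p x₀ x)
        ((2 * (ω x * (p x - p x₀))) • fderiv ℝ ω x + (ω x ^ 2 - ω x₀ ^ 2) • fderiv ℝ p x
          + (2 * p x₀) • ((ω x - ω x₀) • fderiv ℝ ω x
            + ω x₀ • (fderiv ℝ ω x - fderiv ℝ ω x₀))) x := by
      have e1 := ((hωd.hasFDerivAt.pow 2).mul (hpd x).hasFDerivAt)
      have e2 := ((hpd x).hasFDerivAt.const_mul (ω x₀ ^ 2)).add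
        ((((fderiv ℝ ω x₀).hasFDerivAt (x := x - x₀)).comp x
          ((hasFDerivAt_id x).sub_const x₀)).const_mul (2 * ω x₀ * p x₀))
      refine (e1.sub e2).congr_fderiv ?_
      ext y
      simp
      ring
    rw [hder.fderiv]
    have hA : |ω x * (p x - p x₀)| ≤ h * G + B / d * h * (2 * P) := by
      have e : ω x * (p x - p x₀) = ω x₀ * (p x - p x₀) + (ω x - ω x₀) * (p x - p x₀) := by ring
      rw [e]
      refine (abs_add_le _ _).trans ?_
      rw [abs_mul, abs_mul]
      gcongr
    have hS : |ω x ^ 2 - ω x₀ ^ 2| ≤ |ω x - ω x₀| * (2 * |ω x₀| + |ω x - ω x₀|) := by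
      have e : ω x ^ 2 - ω x₀ ^ 2 = (ω x - ω x₀) * (2 * ω x₀ + (ω x - ω x₀)) := by ring
      rw [e, abs_mul]
      refine mul_le_mul_of_nonneg_left ((abs_add_le _ _).trans (le_of_eq ?_)) (abs_nonneg _)
      rw [abs_mul, abs_two]
    -- The part linear in `ω x - ω x₀` retains the weight `ω x₀` and is bounded by `G`. The
    -- quadratic part has a spare factor `h`, which pays for the inverse estimate on `∇p`.
    have hS' : |ω x ^ 2 - ω x₀ ^ 2| * ‖fderiv ℝ p x‖
        ≤ B / d * h * (2 * G) + B ^ 2 / d ^ 2 * h * (c * P) := by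
      calc |ω x ^ 2 - ω x₀ ^ 2| * ‖fderiv ℝ p x‖
          ≤ |ω x - ω x₀| * (2 * |ω x₀| + |ω x - ω x₀|) * ‖fderiv ℝ p x‖ := by gcongr
        _ ≤ B / d * h * (2 * |ω x₀| + B / d * h) * ‖fderiv ℝ p x‖ := by gcongr
        _ = B / d * h * (2 * (|ω x₀| * ‖fderiv ℝ p x‖))
            + B ^ 2 / d ^ 2 * h * (h * ‖fderiv ℝ p x‖) := by
            field_simp
        _ ≤ _ := by gcongr
    calc _ ≤ ‖(2 * (ω x * (p x - p x₀))) • fderiv ℝ ω x‖ + ‖(ω x ^ 2 - ω x₀ ^ 2) • fderiv ℝ p x‖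
          + ‖(2 * p x₀) • ((ω x - ω x₀) • fderiv ℝ ω x
            + ω x₀ • (fderiv ℝ ω x - fderiv ℝ ω x₀))‖ := norm_add₃_le
      _ ≤ 2 * |ω x * (p x - p x₀)| * ‖fderiv ℝ ω x‖ + |ω x ^ 2 - ω x₀ ^ 2| * ‖fderiv ℝ p x‖
          + 2 * |p x₀| * (|ω x - ω x₀| * ‖fderiv ℝ ω x‖
            + |ω x₀| * ‖fderiv ℝ ω x - fderiv ℝ ω x₀‖) := by
          refine add_le_add (add_le_add (le_of_eq ?_) (le_of_eq ?_)) ?_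
          · rw [norm_smul, Real.norm_eq_abs, abs_mul, abs_two]
          · rw [norm_smul, Real.norm_eq_abs]
          · rw [norm_smul, Real.norm_eq_abs, abs_mul, abs_two]
            refine mul_le_mul_of_nonneg_left ((norm_add_le _ _).trans (le_of_eq ?_))
              (by positivity)
            rw [norm_smul, norm_smul, Real.norm_eq_abs, Real.norm_eq_abs]
      _ ≤ 2 * (h * G + B / d * h * (2 * P)) * (B / d)
          + (B / d * h * (2 * G) + B ^ 2 / d ^ 2 * h * (c * P))
          + 2 * P * (B / d * h * (B / d) + B * (B / d ^ 2 * h)) := by gcongr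
      _ = 4 * B * (h / d * G) + (8 + c) * B ^ 2 * (h / d ^ 2 * P) := by
          field_simp
          ring
      _ ≤ _ := hfin'

end PointwiseEstimate

/-! ### The superapproximation estimate on one element. -/

section ElementEstimate

variable {n k : ℕ}

/-- Interpolation error in `C¹` on one element, in terms of a polynomial approximation. -/
theorem localInterpolant_error {s : Finset (EuclideanSpace ℝ (Fin n))}
    (hs : IsBarycentric s (baryCoord s)) (hc : s.card = n + 1) (hk : k ≠ 0)
    (hne : (interior (simplexOf s)).Nonempty) {f q : EuclideanSpace ℝ (Fin n) → ℝ}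
    (hf : ContinuousOn f (simplexOf s)) (hq : q ∈ polyFun n k) {h c N : ℝ} (hh : 0 < h)
    (hN : 0 ≤ N) (hfd : ∀ x ∈ interior (simplexOf s), DifferentiableAt ℝ f x)
    (h0 : ∀ x ∈ interior (simplexOf s), |f x - q x| ≤ h * N)
    (h1 : ∀ x ∈ interior (simplexOf s), ‖fderiv ℝ (fun x => f x - q x) x‖ ≤ N)
    (hinv : ∀ u ∈ polyFun n k, ∀ M, (∀ x ∈ interior (simplexOf s), |u x| ≤ M) →
      ∀ x ∈ interior (simplexOf s), h * ‖fderiv ℝ u x‖ ≤ c * M)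
    {x : EuclideanSpace ℝ (Fin n)} (hx : x ∈ interior (simplexOf s)) :
    |f x - localInterpolant k s f x| ≤ h * ((1 + ((k : ℝ) + 1) ^ (n + 1) * (k : ℝ) ^ k) * N) ∧
      ‖fderiv ℝ (fun x => f x - localInterpolant k s f x) x‖
        ≤ (1 + c * (((k : ℝ) + 1) ^ (n + 1) * (k : ℝ) ^ k)) * N := by
  set L : ℝ := ((k : ℝ) + 1) ^ (n + 1) * (k : ℝ) ^ k with hL
  let g : EuclideanSpace ℝ (Fin n) → ℝ := fun x => f x - q x
  let I := localInterpolant k s g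
  have hqc : ContDiff ℝ 1 q := contDiff_of_mem_polyFun hq
  have hI : I ∈ polyFun n k := localInterpolant_mem_polyFun g
  have hIc : ContDiff ℝ 1 I := contDiff_of_mem_polyFun hI
  have hgI : ∀ y, f y - localInterpolant k s f y = g y - I y := by
    intro y
    have := congrFun (localInterpolant_sub (k := k) (s := s) f q) y
    rw [localInterpolant_of_mem_polyFun hs hk hq] at this
    simp only [I, g]
    rw [this]
    ring
  -- Nodes may lie on the boundary, whereas the bound on `g` is given in the interior; density and
  -- continuity carry it over.
  have hclosure : simplexOf s ⊆ closure (interior (simplexOf s)) := by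
    rw [(convex_simplexOf s).closure_interior_eq_closure_of_nonempty_interior hne]
    exact subset_closure
  have hg : ∀ y ∈ simplexOf s, |g y| ≤ h * N := by
    intro y hy
    have hcg : ContinuousOn g (simplexOf s) := hf.sub hqc.continuous.continuousOn
    have hw : ContinuousWithinAt (fun z => |g z|) (interior (simplexOf s)) y :=
      (hcg.abs y hy).mono interior_subset
    have : (nhdsWithin y (interior (simplexOf s))).NeBot :=
      mem_closure_iff_nhdsWithin_neBot.1 (hclosure hy)
    exact le_of_tendsto hw (Filter.eventually_of_mem self_mem_nhdsWithin h0)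
  have hIb : ∀ y ∈ interior (simplexOf s), |I y| ≤ L * (h * N) := fun y hy =>
    abs_localInterpolant_le hs hc (by positivity)
      (fun z hz => hg z (lagrangeNodes_subset hk hz)) (interior_subset hy)
  have hDI : ‖fderiv ℝ I x‖ ≤ c * L * N := by
    have := hinv I hI _ hIb x hx
    refine le_of_mul_le_mul_left (this.trans (le_of_eq ?_)) hh
    ring
  constructor
  · rw [hgI]
    have e1 := abs_sub (g x) (I x)
    have e2 := h0 x hx
    have e3 := hIb x hx
    calc |g x - I x| ≤ |g x| + |I x| := e1
      _ ≤ h * N + L * (h * N) := add_le_add e2 e3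
      _ = _ := by ring
  · have hgd : DifferentiableAt ℝ g x := (hfd x hx).sub (hqc.differentiable one_ne_zero x)
    have e : fderiv ℝ (fun x => f x - localInterpolant k s f x) x
        = fderiv ℝ g x - fderiv ℝ I x := by
      rw [funext hgI]
      exact fderiv_fun_sub hgd (hIc.differentiable one_ne_zero x)
    rw [e]
    calc _ ≤ ‖fderiv ℝ g x‖ + ‖fderiv ℝ I x‖ := norm_sub_le _ _
      _ ≤ N + c * L * N := add_le_add (h1 x hx) hDI
      _ = _ := by ring

/-- The Riesz isomorphism is isometric, so gradient and derivative have the same pointwise norm. -/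
theorem gradL2Norm_eq_eLpNorm_fderiv (u : EuclideanSpace ℝ (Fin n) → ℝ)
    (U : Set (EuclideanSpace ℝ (Fin n))) :
    gradL2Norm u U = eLpNorm (fderiv ℝ u) 2 (volume.restrict U) :=
  eLpNorm_congr_norm_ae (Filter.Eventually.of_forall fun x => by
    simp [gradient])

theorem l2Norm_congr {u v : EuclideanSpace ℝ (Fin n) → ℝ} {U : Set (EuclideanSpace ℝ (Fin n))}
    (hU : IsOpen U) (h : Set.EqOn u v U) : l2Norm u U = l2Norm v U :=
  eLpNorm_congr_ae (by
    filter_upwards [ae_restrict_mem hU.measurableSet] with x hx using h hx)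

theorem gradL2Norm_congr {u v : EuclideanSpace ℝ (Fin n) → ℝ}
    {U : Set (EuclideanSpace ℝ (Fin n))} (hU : IsOpen U) (h : Set.EqOn u v U) :
    gradL2Norm u U = gradL2Norm v U := by
  rw [gradL2Norm_eq_eLpNorm_fderiv, gradL2Norm_eq_eLpNorm_fderiv]
  refine eLpNorm_congr_ae ?_
  filter_upwards [ae_restrict_mem hU.measurableSet] with x hx
  exact (Filter.eventuallyEq_of_mem (hU.mem_nhds hx) h).fderiv_eq

theorem h1Norm_congr {u v : EuclideanSpace ℝ (Fin n) → ℝ}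
    {U : Set (EuclideanSpace ℝ (Fin n))} (hU : IsOpen U) (h : Set.EqOn u v U) :
    h1Norm u U = h1Norm v U := by
  rw [h1Norm, h1Norm, l2Norm_congr hU h, gradL2Norm_congr hU h]

theorem h1Norm_le_add (u : EuclideanSpace ℝ (Fin n) → ℝ) (U : Set (EuclideanSpace ℝ (Fin n))) :
    h1Norm u U ≤ l2Norm u U + gradL2Norm u U := by
  have h : l2Norm u U ^ 2 + gradL2Norm u U ^ 2 ≤ (l2Norm u U + gradL2Norm u U) ^ 2 := by
    have e : (l2Norm u U + gradL2Norm u U) ^ 2 = l2Norm u U ^ 2 + gradL2Norm u U ^ 2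
        + 2 * l2Norm u U * gradL2Norm u U := by ring
    rw [e]
    exact le_self_add
  calc h1Norm u U ≤ ((l2Norm u U + gradL2Norm u U) ^ 2) ^ (1 / 2 : ℝ) :=
        ENNReal.rpow_le_rpow h (by norm_num)
    _ = _ := by
        rw [← ENNReal.rpow_natCast, ← ENNReal.rpow_mul]
        norm_num

theorem eLpNorm_two_le_of_bound {F : Type*} [NormedAddCommGroup F]
    {u : EuclideanSpace ℝ (Fin n) → F} {U : Set (EuclideanSpace ℝ (Fin n))} (hU : IsOpen U)
    {M : ℝ} (h : ∀ x ∈ U, ‖u x‖ ≤ M) :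
    eLpNorm u 2 (volume.restrict U) ≤ ENNReal.ofReal M * volume U ^ (1 / 2 : ℝ) := by
  have := eLpNorm_le_of_ae_bound (p := 2) (μ := volume.restrict U) (f := u) (C := M)
    (by filter_upwards [ae_restrict_mem hU.measurableSet] with x hx using h x hx)
  rw [mul_comm]
  simpa using this

/-- The superapproximation estimate on one element, for a polynomial `p` of degree at most `k`. -/
theorem exists_element_estimate (n k : ℕ) (hk : k ≠ 0) {c₁ B D : ℝ} (hc₁ : 0 < c₁) (hB : 0 < B) :
    ∃ C : ℝ, 0 < C ∧ ∀ s : Finset (EuclideanSpace ℝ (Fin n)), IsBarycentric s (baryCoord s) →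
      s.card = n + 1 → 0 < simplexDiam s → simplexDiam s ≤ D →
      ∀ x₀, Metric.closedBall x₀ (c₁ * simplexDiam s / 2) ⊆ simplexOf s →
      ∀ d : ℝ, simplexDiam s ≤ d →
      ∀ ω : EuclideanSpace ℝ (Fin n) → ℝ, ContDiffOn ℝ 2 ω (interior (simplexOf s)) →
        ContinuousOn ω (simplexOf s) → (∀ x ∈ interior (simplexOf s), |ω x| ≤ B) →
        (∀ x ∈ interior (simplexOf s), ‖fderiv ℝ ω x‖ ≤ B / d) →
        (∀ x ∈ interior (simplexOf s), ‖fderiv ℝ (fderiv ℝ ω) x‖ ≤ B / d ^ 2) →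
      ∀ p ∈ polyFun n k,
        h1Norm (fun x => ω x ^ 2 * p x - localInterpolant k s (fun x => ω x ^ 2 * p x) x)
            (interior (simplexOf s)) ≤
          ENNReal.ofReal C *
            (ENNReal.ofReal (simplexDiam s / d) *
                gradL2Norm (fun x => ω x * p x) (interior (simplexOf s)) +
              ENNReal.ofReal (simplexDiam s / d ^ 2) * l2Norm p (interior (simplexOf s))) := by
  obtain ⟨c, hc, hE⟩ := exists_shape_regular_estimate n k (ρ := c₁ / 2) (by positivity)
  set L : ℝ := ((k : ℝ) + 1) ^ (n + 1) * (k : ℝ) ^ k with hL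
  have hL0 : 0 ≤ L := by positivity
  let Cg := 4 * B + (8 + c) * B ^ 2
  have hCg : 0 < Cg := by positivity
  -- The first summand accounts for the `L²` part of the `H¹` norm, which has an extra factor `h ≤ D
  -- ≤ |D|`; the second accounts for the gradient part.
  let C₃ := (|D| * (1 + L) + (1 + c * L)) * Cg
  have hC₃ : 0 < C₃ := by positivity
  refine ⟨C₃ * (c + (B * c + B) * c ^ 2), by positivity, ?_⟩
  intro s hs hcard hh hhD x₀ hball d hhd ω hω hωc h0 h1 h2 p hp
  set h := simplexDiam s with hh_def
  set K := interior (simplexOf s) with hK_def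
  have hd : 0 < d := hh.trans_le hhd
  have hKo : IsOpen K := isOpen_interior
  have hKc : Convex ℝ K := (convex_simplexOf s).interior
  have hballK : Metric.ball x₀ (c₁ / 2 * h) ⊆ K := by
    refine interior_maximal (subset_trans ?_ hball) Metric.isOpen_ball
    rw [mul_div_right_comm]
    exact Metric.ball_subset_closedBall
  have hx₀ : x₀ ∈ K := hballK (Metric.mem_ball_self (by positivity))
  -- Since `h` is the diameter, the outer ball can share the centre `x₀` of the inner one.
  have hKball : K ⊆ Metric.closedBall x₀ h := fun x hx =>
    Metric.dist_le_diam_of_mem (isCompact_simplexOf s).isBounded (interior_subset hx)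
      (interior_subset hx₀)
  have hKball' : ∀ x ∈ K, ‖x - x₀‖ ≤ h := fun x hx => mem_closedBall_iff_norm.1 (hKball hx)
  have hvol : volume K ≠ ⊤ :=
    ((measure_mono hKball).trans_lt measure_closedBall_lt_top).ne
  have hvol0 : volume K ≠ 0 := (hKo.measure_pos volume ⟨x₀, hx₀⟩).ne'
  set V : ℝ≥0∞ := volume K ^ (1 / 2 : ℝ) with hV
  have hVt : V ≠ ⊤ := ENNReal.rpow_ne_top_of_nonneg (by norm_num) hvol
  have hV0 : V ≠ 0 := by simp [hV, ENNReal.rpow_eq_zero_iff, hvol0, hvol]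
  have hE' : ∀ u ∈ polyFun n k, ∀ x ∈ K,
      ENNReal.ofReal |u x| * V ≤ ENNReal.ofReal c * eLpNorm u 2 (volume.restrict K) ∧
      ENNReal.ofReal (h * ‖fderiv ℝ u x‖) * V
        ≤ ENNReal.ofReal c * eLpNorm u 2 (volume.restrict K) := fun u hu x hx =>
    hE u hu x₀ h hh K hballK hKball x (hKball hx)
  have hinv : ∀ u ∈ polyFun n k, ∀ M, (∀ x ∈ K, |u x| ≤ M) →
      ∀ x ∈ K, h * ‖fderiv ℝ u x‖ ≤ c * M := by
    intro u hu M hM x hx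
    have hM0 : 0 ≤ M := (abs_nonneg _).trans (hM x hx)
    have e := ((hE' u hu x hx).2).trans
      (mul_le_mul_right (eLpNorm_two_le_of_bound hKo hM) (ENNReal.ofReal c))
    rw [← hV, ← mul_assoc, ← ENNReal.ofReal_mul hc.le, ENNReal.mul_le_mul_iff_left hV0 hVt] at e
    exact (ENNReal.ofReal_le_ofReal_iff (by positivity)).1 e
  have div_bound : ∀ (t : ℝ) (N : ℝ≥0∞), N ≠ ⊤ → ENNReal.ofReal t * V ≤ ENNReal.ofReal c * N →
      t ≤ (ENNReal.ofReal c * N / V).toReal := by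
    intro t N hN ht
    have e : ENNReal.ofReal t ≤ ENNReal.ofReal c * N / V :=
      (ENNReal.le_div_iff_mul_le (Or.inl hV0) (Or.inl hVt)).2 ht
    exact (ENNReal.ofReal_le_iff_le_toReal
      (ENNReal.div_ne_top (ENNReal.mul_ne_top ENNReal.ofReal_ne_top hN) hV0)).1 e
  have div_mul : ∀ N : ℝ≥0∞, N ≠ ⊤ →
      ENNReal.ofReal (ENNReal.ofReal c * N / V).toReal * V = ENNReal.ofReal c * N := by
    intro N hN
    rw [ENNReal.ofReal_toReal
      (ENNReal.div_ne_top (ENNReal.mul_ne_top ENNReal.ofReal_ne_top hN) hV0),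
      ENNReal.div_mul_cancel hV0 hVt]
  have hpc : ContDiff ℝ 1 p := contDiff_of_mem_polyFun hp
  have hpd : Differentiable ℝ p := hpc.differentiable one_ne_zero
  -- the two quantities that control `p`
  let X : ℝ≥0∞ := eLpNorm p 2 (volume.restrict K)
  let Y : ℝ≥0∞ := eLpNorm (fun x => ω x₀ • fderiv ℝ p x) 2 (volume.restrict K)
  have hX : X ≠ ⊤ := by
    obtain ⟨M, hM⟩ := (isCompact_closedBall x₀ h).exists_bound_of_continuousOn
      hpc.continuous.continuousOn
    exact ((eLpNorm_two_le_of_bound hKo fun x hx => hM x (hKball hx)).trans_lt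
      (ENNReal.mul_lt_top ENNReal.ofReal_lt_top hVt.lt_top)).ne
  have hY : Y ≠ ⊤ := by
    obtain ⟨M, hM⟩ := (isCompact_closedBall x₀ h).exists_bound_of_continuousOn
      ((hpc.continuous_fderiv one_ne_zero).const_smul (ω x₀)).continuousOn
    exact ((eLpNorm_two_le_of_bound hKo fun x hx => hM x (hKball hx)).trans_lt
      (ENNReal.mul_lt_top ENNReal.ofReal_lt_top hVt.lt_top)).ne
  -- These choices give `P V = c X` and `G V = c Y` exactly, so multiplying the pointwise bounds by
  -- `V = |K|^{1/2}` restores `L²` norms.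
  let P : ℝ := (ENNReal.ofReal c * X / V).toReal
  let G : ℝ := (ENNReal.ofReal c * Y / V).toReal
  have hP0 : 0 ≤ P := ENNReal.toReal_nonneg
  have hG0 : 0 ≤ G := ENNReal.toReal_nonneg
  have hpP : ∀ x ∈ K, |p x| ≤ P := fun x hx => div_bound _ X hX (hE' p hp x hx).1
  have hpc' := hinv p hp P hpP
  have hpG : ∀ x ∈ K, |ω x₀| * ‖fderiv ℝ p x‖ ≤ G := by
    intro x hx
    have e : ‖ω x₀ • fderiv ℝ p x‖ ≤ G := by
      -- In each unit direction the weighted derivative is a scalar polynomial, to which the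
      -- sup–`L²` estimate applies.
      refine ContinuousLinearMap.opNorm_le_of_unit_norm hG0 fun e he => ?_
      have hu : (fun y => ω x₀ * fderiv ℝ p y e) ∈ polyFun n k :=
        (polyFun n k).smul_mem (ω x₀) (fderiv_apply_mem_polyFun hp e)
      refine div_bound _ Y hY (((hE' _ hu x hx).1).trans ?_)
      refine mul_le_mul_right (eLpNorm_mono fun y => ?_) _
      have := (ω x₀ • fderiv ℝ p y).le_opNorm e
      rw [he, mul_one] at this
      exact this
    rwa [norm_smul, Real.norm_eq_abs] at e
  -- pointwise estimates
  set M : ℝ := h / d * G + h / d ^ 2 * P with hM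
  have hM0 : 0 ≤ M := by positivity
  have happ := fun x (hx : x ∈ K) => localApprox_bounds hKo hKc hω hpc hB.le hd hh.le hP0 hG0 hc.le
    h0 h1 h2 hx₀ hx hKball' hpP hpc' hpG
  have hωd : ∀ x ∈ K, DifferentiableAt ℝ ω x := fun x hx =>
    (hω.contDiffAt (hKo.mem_nhds hx)).differentiableAt (by norm_num)
  have herr := fun x (hx : x ∈ K) => localInterpolant_error hs hcard hk ⟨x₀, hx₀⟩
    (f := fun x => ω x ^ 2 * p x)
    ((hωc.pow 2).mul hpc.continuous.continuousOn) (localApprox_mem_polyFun hk ω hp x₀) hh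
    (N := Cg * M) (by positivity) (fun x hx => ((hωd x hx).pow 2).mul (hpd x))
    (fun x hx => (happ x hx).1) (fun x hx => (happ x hx).2) hinv hx
  have hbound : h1Norm (fun x => ω x ^ 2 * p x - localInterpolant k s (fun x => ω x ^ 2 * p x) x) K
      ≤ ENNReal.ofReal C₃ * (ENNReal.ofReal M * V) := by
    refine (h1Norm_le_add _ _).trans ?_
    rw [gradL2Norm_eq_eLpNorm_fderiv, l2Norm]
    refine (add_le_add (eLpNorm_two_le_of_bound hKo fun x hx => (herr x hx).1)
      (eLpNorm_two_le_of_bound hKo fun x hx => (herr x hx).2)).trans ?_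
    rw [← hV, ← hL, ← add_mul, ← mul_assoc (ENNReal.ofReal C₃), ← ENNReal.ofReal_add (by positivity) (by positivity),
      ← ENNReal.ofReal_mul hC₃.le]
    gcongr
    have e : h * ((1 + L) * (Cg * M)) ≤ |D| * ((1 + L) * (Cg * M)) :=
      mul_le_mul_of_nonneg_right (hhD.trans (le_abs_self D)) (by positivity)
    calc _ ≤ |D| * ((1 + L) * (Cg * M)) + (1 + c * L) * (Cg * M) := by linarith
      _ = C₃ * M := by simp only [C₃]; ring
  refine hbound.trans ?_
  -- `L²` estimate of the gradient of `ω(x₀) p`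
  have hYle : Y ≤ gradL2Norm (fun x => ω x * p x) K
      + ENNReal.ofReal ((B * c + B) / d) * (ENNReal.ofReal c * X) := by
    rw [gradL2Norm_eq_eLpNorm_fderiv, ← div_mul X hX, ← mul_assoc,
      ← ENNReal.ofReal_mul (by positivity)]
    have e : (fun x => ω x₀ • fderiv ℝ p x) = fderiv ℝ (fun x => ω x * p x)
        + fun x => ω x₀ • fderiv ℝ p x - fderiv ℝ (fun x => ω x * p x) x := by
      ext x
      simp
    have m1 : Measurable (fderiv ℝ (fun x => ω x * p x)) := measurable_fderiv ℝ _
    have m2 : Measurable (fun x => ω x₀ • fderiv ℝ p x) :=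
      (measurable_fderiv ℝ p).const_smul (ω x₀)
    have step := eLpNorm_add_le (μ := volume.restrict K) (p := 2) m1.aestronglyMeasurable
      (m2.sub m1).aestronglyMeasurable one_le_two
    simp only [Y]
    conv_lhs => rw [e]
    refine step.trans (add_le_add le_rfl (eLpNorm_two_le_of_bound hKo fun x hx => ?_))
    have hder : fderiv ℝ (fun x => ω x * p x) x = ω x • fderiv ℝ p x + p x • fderiv ℝ ω x :=
      fderiv_fun_mul (hωd x hx) (hpd x)
    -- By the product rule the discrepancy contains only the increment of `ω` times `∇p`, handled by
    -- the inverse estimate, and `p ∇ω`; both are of order `P/d`.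
    have e2 : ω x₀ • fderiv ℝ p x - fderiv ℝ (fun x => ω x * p x) x
        = -((ω x - ω x₀) • fderiv ℝ p x) - p x • fderiv ℝ ω x := by
      rw [hder, sub_smul]
      abel
    have t1 := (taylor_bounds hKo hKc hω hB.le hd hh.le h1 h2 hx₀ hx hKball').1
    have t2 := hpc' x hx
    have t3 := hpP x hx
    have t4 := h1 x hx
    simp only [Pi.sub_apply]
    rw [e2]
    calc _ ≤ ‖(ω x - ω x₀) • fderiv ℝ p x‖ + ‖p x • fderiv ℝ ω x‖ := by
          refine (norm_sub_le _ _).trans ?_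
          rw [norm_neg]
      _ = |ω x - ω x₀| * ‖fderiv ℝ p x‖ + |p x| * ‖fderiv ℝ ω x‖ := by
          rw [norm_smul, norm_smul, Real.norm_eq_abs, Real.norm_eq_abs]
      _ ≤ B / d * h * ‖fderiv ℝ p x‖ + P * (B / d) := by gcongr
      _ = B / d * (h * ‖fderiv ℝ p x‖) + P * (B / d) := by ring
      _ ≤ B / d * (c * P) + P * (B / d) := by gcongr
      _ = _ := by simp only [P]; ring
  have hMV : ENNReal.ofReal M * V
      = ENNReal.ofReal (h / d) * (ENNReal.ofReal c * Y)
        + ENNReal.ofReal (h / d ^ 2) * (ENNReal.ofReal c * X) := by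
    rw [hM, ENNReal.ofReal_add (by positivity) (by positivity),
      ENNReal.ofReal_mul (by positivity), ENNReal.ofReal_mul (by positivity), add_mul, mul_assoc,
      mul_assoc, div_mul X hX, div_mul Y hY]
  rw [ENNReal.ofReal_mul hC₃.le, mul_assoc (ENNReal.ofReal C₃)]
  refine mul_le_mul_right ?_ _
  rw [hMV]
  set Γ := gradL2Norm (fun x => ω x * p x) K
  have e1 : ENNReal.ofReal (h / d) * (ENNReal.ofReal c * Y)
      ≤ ENNReal.ofReal c * (ENNReal.ofReal (h / d) * Γ)
        + ENNReal.ofReal ((B * c + B) * c ^ 2) * (ENNReal.ofReal (h / d ^ 2) * X) := by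
    have e : ENNReal.ofReal ((B * c + B) * c ^ 2) * ENNReal.ofReal (h / d ^ 2)
        = ENNReal.ofReal (h / d) * ENNReal.ofReal c * ENNReal.ofReal ((B * c + B) / d)
          * ENNReal.ofReal c := by
      rw [← ENNReal.ofReal_mul (by positivity), ← ENNReal.ofReal_mul (by positivity),
        ← ENNReal.ofReal_mul (by positivity), ← ENNReal.ofReal_mul (by positivity)]
      congr 1
      field_simp
    calc _ ≤ ENNReal.ofReal (h / d) * (ENNReal.ofReal c *
          (Γ + ENNReal.ofReal ((B * c + B) / d) * (ENNReal.ofReal c * X))) := by gcongr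
      _ = ENNReal.ofReal c * (ENNReal.ofReal (h / d) * Γ)
          + ENNReal.ofReal (h / d) * ENNReal.ofReal c * ENNReal.ofReal ((B * c + B) / d)
            * ENNReal.ofReal c * X := by ring
      _ = _ := by rw [← e]; ring
  rw [ENNReal.ofReal_add hc.le (by positivity), add_mul, mul_add, mul_add]
  refine (add_le_add e1 le_rfl).trans ?_
  have hXl : l2Norm p K = X := rfl
  rw [hXl]
  have e2 : ENNReal.ofReal (h / d ^ 2) * (ENNReal.ofReal c * X)
      = ENNReal.ofReal c * (ENNReal.ofReal (h / d ^ 2) * X) := by ring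
  rw [e2]
  -- The larger coefficient is needed only for `X`; a surplus multiple of `Γ` is added to have one
  -- common constant.
  calc _ ≤ ENNReal.ofReal c * (ENNReal.ofReal (h / d) * Γ)
        + ENNReal.ofReal ((B * c + B) * c ^ 2) * (ENNReal.ofReal (h / d ^ 2) * X)
        + ENNReal.ofReal c * (ENNReal.ofReal (h / d ^ 2) * X)
        + ENNReal.ofReal ((B * c + B) * c ^ 2) * (ENNReal.ofReal (h / d) * Γ) := le_self_add
    _ = _ := by ring

end ElementEstimate

/-! ### Assembly of the global statement. -/

theorem theorem2p1 (n r : ℕ) (hn : 1 ≤ n) (hr : 2 ≤ r) (c₁ C₁ A D : ℝ)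
    (hc₁ : 0 < c₁) (hC₁ : 0 < C₁) (hA : 0 < A) :
    ∃ C : ℝ, 0 < C ∧
      ∀ (Ω : Set (EuclideanSpace ℝ (Fin n))), IsPolyhedralDomain Ω → Metric.diam Ω ≤ D →
      ∀ 𝒯 : SimplicialDecomposition Ω, 𝒯.ShapeRegular c₁ C₁ →
      ∀ (d : ℝ), 0 < d →
      ∀ ω : EuclideanSpace ℝ (Fin n) → ℝ,
        ContDiffOn ℝ ((⊤ : ℕ∞) : WithTop ℕ∞) ω Ω → ContinuousOn ω (closure Ω) →
        (∀ j ≤ r, wInftySeminorm j ω Ω ≤ ENNReal.ofReal (A * (d ^ j)⁻¹)) →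
      ∀ χ ∈ 𝒯.lagrangeSpace (r - 1),
      ∃ η ∈ 𝒯.lagrangeSpace (r - 1),
        𝒯.IsLagrangeInterpolant (r - 1) (fun x => ω x ^ 2 * χ x) η ∧
        ∀ T ∈ 𝒯.elements, simplexDiam T ≤ d →
          h1Norm (fun x => ω x ^ 2 * χ x - η x) (interior (simplexOf T)) ≤
            ENNReal.ofReal C *
              (ENNReal.ofReal (simplexDiam T / d) *
                  gradL2Norm (fun x => ω x * χ x) (interior (simplexOf T)) +
                ENNReal.ofReal (simplexDiam T / d ^ 2) *
                  l2Norm χ (interior (simplexOf T))) := by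
  have hk : r - 1 ≠ 0 := by omega
  have hn' : (0 : ℝ) < n := by exact_mod_cast hn
  have hB : 0 < (n : ℝ) ^ 2 * A := by positivity
  obtain ⟨C, hC, hE⟩ := exists_element_estimate n (r - 1) hk (D := D) hc₁ hB
  refine ⟨C, hC, ?_⟩
  intro Ω hΩ hD 𝒯 h𝒯 d hd ω hω hωc hωb χ hχ
  obtain ⟨η, hη, hηloc⟩ := 𝒯.exists_isLagrangeInterpolant hk fun x => ω x ^ 2 * χ x
  refine ⟨η, hη.1, hη, fun T hT hTd => ?_⟩
  obtain ⟨⟨x₀, hx₀⟩, -⟩ := h𝒯 T hT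
  obtain ⟨q, hq, hχq⟩ := hχ.2 T hT
  let p : EuclideanSpace ℝ (Fin n) → ℝ := fun x => MvPolynomial.eval (fun i => x i) q
  have hp : p ∈ polyFun n (r - 1) := mem_polyFun.2 ⟨q, hq, fun _ => rfl⟩
  have hTΩ : simplexOf T ⊆ closure Ω := 𝒯.simplexOf_subset_closure hT
  -- `Ω` being the interior of its closure ensures that the bounds on `ω` hold at every interior
  -- point of `T`.
  have hKΩ : interior (simplexOf T) ⊆ Ω := by
    rw [← hΩ.interior_closure]
    exact interior_mono hTΩ
  have hb := fun x (hx : x ∈ interior (simplexOf T)) =>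
    bounds_of_wInftySeminorm_le hn hΩ.isOpen hω hA hd (fun j hj => hωb j (hj.trans hr)) (hKΩ hx)
  have hKo : IsOpen (interior (simplexOf T)) := isOpen_interior
  have key := hE T (𝒯.isBarycentric_of_mem_elements hT) hT.2 (𝒯.simplexDiam_pos hn hT)
    ((𝒯.simplexDiam_le_diam hT).trans hD) x₀ hx₀ d hTd ω
    ((hω.mono hKΩ).of_le (WithTop.coe_le_coe.2 (le_top : (2 : ℕ∞) ≤ ⊤))) (hωc.mono hTΩ) (fun x hx => (hb x hx).1)
    (fun x hx => (hb x hx).2.1) (fun x hx => (hb x hx).2.2) p hp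
  have hloc : localInterpolant (r - 1) T (fun x => ω x ^ 2 * χ x)
      = localInterpolant (r - 1) T (fun x => ω x ^ 2 * p x) :=
    localInterpolant_congr fun z hz => by rw [hχq z (lagrangeNodes_subset hk hz)]
  -- `χ` and `η` are polynomial only on `T`; equality on the open interior is enough for the norms,
  -- gradients included.
  have e1 : Set.EqOn (fun x => ω x ^ 2 * χ x - η x)
      (fun x => ω x ^ 2 * p x - localInterpolant (r - 1) T (fun x => ω x ^ 2 * p x) x)
      (interior (simplexOf T)) := fun x hx => by
    simp only [hηloc T hT x (interior_subset hx), hloc, hχq x (interior_subset hx), p]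
  have e2 : Set.EqOn (fun x => ω x * χ x) (fun x => ω x * p x) (interior (simplexOf T)) :=
    fun x hx => by simp only [hχq x (interior_subset hx), p]
  have e3 : Set.EqOn χ p (interior (simplexOf T)) := fun x hx => hχq x (interior_subset hx)
  rw [h1Norm_congr hKo e1, gradL2Norm_congr hKo e2, l2Norm_congr hKo e3]
  exact key
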